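/- Let $k$ be a commutative ring with unit, $d\ge 0$, $\mathfrak m=(x_1,\dots,x_d)\subset k[x_1,\dots,x_d]$, $A=k[x_1,\dots,x_d]/\mathfrak m^2$ and $\bar{\mathfrak m}=\mathfrak m/\mathfrak m^2$. For a $k$-algebra $B$, let $CC_{p,q}(B)=B^{\otimes_k (q+1)}$ ($p\in\mathbb Z$, $q\ge 0$) be the periodic cyclic bicomplex: the even columns are the Hochschild complex $(B^{\otimes *+1},b)$, the odd columns the bar complex $(B^{\otimes *+1},-b')$, and the horizontal maps from column $p$ to column $p-1$ are $1-t_q$ for $p$ odd and $N_q=1+t_q+\dots+t_q^q$ for $p$ even, where $t_q(a_0\otimes\cdots\otimes a_q)=(-1)^q a_q\otimes a_0\otimes\cdots\otimes a_{q-1}$. The periodic cyclic homology $HP_n(B)$ is the $n$-th homology of its total complex $\mathrm{Tot}_n=\prod_{p+q=n}CC_{p,q}(B)$ (product totalization). For $A=k[x_1,\dots,x_d]/\mathfrak m^2$, the weight of a tensor monomial with factors in $\{1,x_1,\dots,x_d\}$ is the number of its factors different from $1$. Each $A^{\otimes r}$ is the direct sum over $w\ge 0$ of its parts of weight $w$ (the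 spans of the tensor monomials of weight $w$), and the differentials preserve weight. Let $HP^{(w)}_n(A)$ be the $n$-th homology of the subcomplex of $\mathrm{Tot}_*$ of the families all of whose entries have weight $w$. Then, for every $n\in\mathbb Z$: 1. Decomposing cycles into their weight components induces an isomorphism of $k$-modules $$HP_n(A)\;\cong\;\prod_{w\ge 0}HP_n^{(w)}(A),$$ under which the map $HP^{(w)}_n(A)\to HP_n(A)$ induced by the inclusion of the weight $w$ subcomplex is the inclusion of the $w$-th factor. 2. $HP^{(0)}_n(A)\cong k$ if $n$ is even, and $HP^{(0)}_n(A)=0$ if $n$ is odd. 3. For $w>0$ let the cyclic group $C_w=\langle\alpha:\alpha^w=1\rangle$ act on $\bar{\mathfrak m}^{\otimes_k w}$ by $$\alpha(y_1\otimes\cdots\otimes y_w)=t(y_1\otimes\cdots\otimes y_w)=(-1)^{w-1}\,y_w\otimes y_1\otimes\cdots\otimes y_{w-1},$$ and let $N=1+t+\dots+t^{w-1}$, which induces a map $N:\operatorname{coker}(1-t)\to\ker(1-t)$. There are isomorphisms of $k$-modules $$HP_n^{(w)}(A)\cong\begin{cases}\operatorname{coker}\bigl(N:\operatorname{coker}(1-t)\to\ker(1-t)\bigr)&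 n-w\text{ even},\\ \ker\bigl(N:\operatorname{coker}(1-t)\to\ker(1-t)\bigr)& n-w\text{ odd},\end{cases}$$ and $$HP_n^{(w)}(A)\cong\hat H^{\,w-n}(C_w;\bar{\mathfrak m}^{\otimes w})\qquad\text{(Tate cohomology)}.$$ -/

import Mathlib

open scoped TensorProduct

noncomputable section

namespace CyclicHomology

universe u

section Operators

variable (k : Type u) [CommRing k]

/-- The rotation `a₁ ⊗ ⋯ ⊗ aₙ ↦ aₙ ⊗ a₁ ⊗ ⋯ ⊗ aₙ₋₁` of `M^{⊗ n}`, without sign. -/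
def rotate (M : Type u) [AddCommGroup M] [Module k M] (n : ℕ) : Module.End k (⨂[k]^n M) :=
  (PiTensorProduct.reindex k (fun _ : Fin n => M) (finRotate n)).toLinearMap

/-- The signed rotation `a₁ ⊗ ⋯ ⊗ aₙ ↦ (-1)^{n-1} aₙ ⊗ a₁ ⊗ ⋯ ⊗ aₙ₋₁` of `M^{⊗ n}`
(the operator `t_{n-1}`, when it is indexed by the simplicial degree). -/
def cyc (M : Type u) [AddCommGroup M] [Module k M] (n : ℕ) : Module.End k (⨂[k]^n M) :=
  (-1 : k) ^ (n - 1) • rotate k M n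

/-- The operator `1 - t` of `M^{⊗ n}`, where `t` is the signed rotation. -/
abbrev oneSubCyc (M : Type u) [AddCommGroup M] [Module k M] (n : ℕ) : Module.End k (⨂[k]^n M) :=
  1 - cyc k M n

/-- The norm operator `1 + t + ⋯ + t^{n-1}` of `M^{⊗ n}`, where `t` is the signed rotation. -/
def cycNorm (M : Type u) [AddCommGroup M] [Module k M] (n : ℕ) : Module.End k (⨂[k]^n M) :=
  ∑ j ∈ Finset.range n, cyc k M n ^ j

theorem finRotate_pow_self (n : ℕ) : finRotate n ^ n = 1 := by
  cases n with
  | zero => rfl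
  | succ m =>
    have h : ∀ (j : ℕ) (i : Fin (m + 1)),
        (finRotate (m + 1) ^ j) i = i + Fin.ofNat (m + 1) j := by
      intro j
      induction j with
      | zero => intro i; simp
      | succ j ih =>
        intro i
        rw [pow_succ', Equiv.Perm.mul_apply, ih, finRotate_apply]
        ext
        simp [Fin.val_add, add_assoc]
    ext i
    rw [h]
    simp

variable (M : Type u) [AddCommGroup M] [Module k M] (n : ℕ)

theorem rotate_tprod (a : Fin n → M) :
    rotate k M n (PiTensorProduct.tprod k a) =
      PiTensorProduct.tprod k (fun i => a ((finRotate n).symm i)) := by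
  simp [rotate]

theorem rotate_pow_self : rotate k M n ^ n = 1 := by
  have h : ∀ (j : ℕ) (a : Fin n → M), (rotate k M n ^ j) (PiTensorProduct.tprod k a) =
      PiTensorProduct.tprod k (fun i => a (((finRotate n) ^ j).symm i)) := by
    intro j
    induction j with
    | zero => intro a; simp; rfl
    | succ j ih =>
      intro a
      rw [pow_succ, Module.End.mul_apply, rotate_tprod, ih, pow_succ]
      rfl
  apply PiTensorProduct.ext
  ext a
  simp only [LinearMap.compMultilinearMap_apply]
  rw [h, finRotate_pow_self]
  rfl

theorem cyc_pow_self : cyc k M n ^ n = 1 := by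
  rw [cyc, smul_pow, rotate_pow_self, ← pow_mul]
  have : Even ((n - 1) * n) := by
    cases n with
    | zero => simp
    | succ m => exact Nat.even_mul_succ_self m
  rw [this.neg_one_pow, one_smul]

theorem one_sub_cyc_mul_cycNorm : (1 - cyc k M n) * cycNorm k M n = 0 := by
  rw [cycNorm, mul_neg_geom_sum, cyc_pow_self, sub_self]

theorem cycNorm_mul_one_sub_cyc : cycNorm k M n * (1 - cyc k M n) = 0 := by
  rw [cycNorm, geom_sum_mul_neg, cyc_pow_self, sub_self]

/-- The map `coker (1 - t) ⟶ ker (1 - t)` induced by the norm operator on `M^{⊗ n}`. -/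
def normMap : ((⨂[k]^n M) ⧸ LinearMap.range (oneSubCyc k M n)) →ₗ[k]
    LinearMap.ker (oneSubCyc k M n) :=
  Submodule.liftQ _
    (LinearMap.codRestrict _ (cycNorm k M n) fun x =>
      LinearMap.congr_fun (one_sub_cyc_mul_cycNorm k M n) x)
    (by
      rintro _ ⟨x, rfl⟩
      exact Subtype.ext (LinearMap.congr_fun (cycNorm_mul_one_sub_cyc k M n) x))

/-- The cyclic group of order `n`, written multiplicatively (in the universe of `k`). -/
abbrev CyclicGroup (n : ℕ) : Type u := ULift.{u} (Multiplicative (ZMod n))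

/-- The action of the cyclic group of order `n` on `M^{⊗ n}` in which the generator `1 mod n`
acts by the signed rotation: the class of `j` acts by its `j`-th power. -/
def cycRep [NeZero n] : Representation k (CyclicGroup.{u} n) (⨂[k]^n M) where
  toFun g := cyc k M n ^ (g.down.toAdd : ZMod n).val
  map_one' := by simp
  map_mul' g h := by
    rw [← pow_add, ULift.mul_down, toAdd_mul, ZMod.val_add]
    exact (pow_eq_pow_mod _ (cyc_pow_self k M n)).symm

end Operators

section Bicomplex

variable (k : Type u) [CommRing k] (A : Type u) [Ring A] [Algebra k A]

theorem contractNth_update (n : ℕ) (i : Fin (n + 1)) (a : Fin (n + 2) → A) (j : Fin (n + 2)) :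
    ∃ (p : Fin (n + 1)) (φ : A →ₗ[k] A), ∀ x : A,
      Fin.contractNth i.castSucc (· * ·) (Function.update a j x) =
        Function.update (Fin.contractNth i.castSucc (· * ·) a) p (φ x) := by
  rcases lt_trichotomy (j : ℕ) i with h | h | h
  · refine ⟨⟨j, by omega⟩, LinearMap.id, fun x => ?_⟩
    ext l
    simp only [Fin.contractNth, Function.update_apply, Fin.ext_iff, Fin.val_castSucc, Fin.val_succ,
      LinearMap.id_apply]
    grind
  · refine ⟨⟨j, by omega⟩, LinearMap.mulRight k (a i.succ), fun x => ?_⟩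
    ext l
    simp only [Fin.contractNth, Function.update_apply, Fin.ext_iff, Fin.val_castSucc, Fin.val_succ,
      LinearMap.mulRight_apply]
    have : l.val = i.val → l = i := fun h => Fin.ext h
    grind
  · by_cases h' : (j : ℕ) = i + 1
    · refine ⟨⟨i, by omega⟩, LinearMap.mulLeft k (a i.castSucc), fun x => ?_⟩
      ext l
      simp only [Fin.contractNth, Function.update_apply, Fin.ext_iff, Fin.val_castSucc,
        Fin.val_succ, LinearMap.mulLeft_apply]
      have : l.val = i.val → l = i := fun h => Fin.ext h
      grind
    · refine ⟨⟨j - 1, by omega⟩, LinearMap.id, fun x => ?_⟩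
      ext l
      simp only [Fin.contractNth, Function.update_apply, Fin.ext_iff, Fin.val_castSucc,
        Fin.val_succ, LinearMap.id_apply]
      grind

/-- The face map `dᵢ : A^{⊗ n+2} ⟶ A^{⊗ n+1}`, `0 ≤ i ≤ n`,
`a₀ ⊗ ⋯ ⊗ aₙ₊₁ ↦ a₀ ⊗ ⋯ ⊗ aᵢaᵢ₊₁ ⊗ ⋯ ⊗ aₙ₊₁`. -/
def face (n : ℕ) (i : Fin (n + 1)) : (⨂[k]^(n + 2) A) →ₗ[k] ⨂[k]^(n + 1) A :=
  PiTensorProduct.lift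
    { toFun := fun a => PiTensorProduct.tprod k (Fin.contractNth i.castSucc (· * ·) a)
      map_update_add' := by
        intro hdec a j x y
        obtain rfl : hdec = instDecidableEqFin _ := Subsingleton.elim _ _
        obtain ⟨p, φ, h⟩ := contractNth_update k A n i a j
        rw [h, h, h, map_add, MultilinearMap.map_update_add]
      map_update_smul' := by
        intro hdec a j c x
        obtain rfl : hdec = instDecidableEqFin _ := Subsingleton.elim _ _
        obtain ⟨p, φ, h⟩ := contractNth_update k A n i a j
        rw [h, h, map_smul, MultilinearMap.map_update_smul] }

/-- The last face map `dₙ₊₁ : A^{⊗ n+2} ⟶ A^{⊗ n+1}`,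
`a₀ ⊗ ⋯ ⊗ aₙ₊₁ ↦ aₙ₊₁a₀ ⊗ a₁ ⊗ ⋯ ⊗ aₙ`: rotate, then multiply the first two factors. -/
def lastFace (n : ℕ) : (⨂[k]^(n + 2) A) →ₗ[k] ⨂[k]^(n + 1) A :=
  face k A n 0 ∘ₗ rotate k A (n + 2)

/-- `b'ₙ₊₁ = ∑_{0 ≤ i ≤ n} (-1)ⁱ dᵢ`. -/
def bar (n : ℕ) : (⨂[k]^(n + 2) A) →ₗ[k] ⨂[k]^(n + 1) A :=
  ∑ i : Fin (n + 1), (-1 : k) ^ (i : ℕ) • face k A n i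

/-- The Hochschild boundary `bₙ₊₁ = ∑_{0 ≤ i ≤ n + 1} (-1)ⁱ dᵢ`. -/
def hochschild (n : ℕ) : (⨂[k]^(n + 2) A) →ₗ[k] ⨂[k]^(n + 1) A :=
  bar k A n + (-1 : k) ^ (n + 1) • lastFace k A n

/-- The vertical differential of the periodic cyclic bicomplex from position `(p, q + 1)` to
position `(p, q)`: `b` in the even columns, `-b'` in the odd ones (the sign turns the commuting
squares into anticommuting ones). -/
def vert (p : ℤ) (q : ℕ) : (⨂[k]^(q + 2) A) →ₗ[k] ⨂[k]^(q + 1) A :=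
  if Even p then hochschild k A q else -bar k A q

/-- The horizontal differential of the periodic cyclic bicomplex from position `(p, q)` to
position `(p - 1, q)`: `N` on the even columns, `1 - t` on the odd ones. -/
def horiz (p : ℤ) (q : ℕ) : Module.End k (⨂[k]^(q + 1) A) :=
  if Even p then cycNorm k A (q + 1) else oneSubCyc k A (q + 1)

/-- The (product) total complex in any degree `n : ℤ`: it is the product, over the `q ≥ 0`, of the
entry `A^{⊗ q+1}` at position `(n - q, q)`. -/
abbrev Tot : Type u := ∀ q : ℕ, ⨂[k]^(q + 1) A

/-- The differential of the total complex from degree `n` to degree `n - 1`. -/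
def totD (n : ℤ) : Tot k A →ₗ[k] Tot k A :=
  LinearMap.pi fun q : ℕ =>
    vert k A (n - (q + 1)) q ∘ₗ LinearMap.proj (q + 1) + horiz k A (n - q) q ∘ₗ LinearMap.proj q

/-- The cycles of degree `n`. -/
abbrev cycles (n : ℤ) : Submodule k (Tot k A) := LinearMap.ker (totD k A n)

/-- The boundaries of degree `n`. -/
abbrev boundaries (n : ℤ) : Submodule k (Tot k A) := LinearMap.range (totD k A (n + 1))

/-- Periodic cyclic homology `HP_n(A)`. -/
abbrev HP (n : ℤ) : Type u := cycles k A n ⧸ (boundaries k A n).submoduleOf (cycles k A n)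

end Bicomplex

section Weight

variable (k : Type u) [CommRing k] (d : ℕ)

/-- The ideal `𝔪 = (x₁, …, x_d)` of `k[x₁, …, x_d]`. -/
def maxIdeal : Ideal (MvPolynomial (Fin d) k) := Ideal.span (Set.range MvPolynomial.X)

/-- `A = k[x₁, …, x_d] / 𝔪²`. -/
abbrev TruncAlg : Type u := MvPolynomial (Fin d) k ⧸ maxIdeal k d ^ 2

/-- `𝔪̄ = 𝔪 / 𝔪²`. -/
abbrev mBar : Type u := (maxIdeal k d).Cotangent

/-- The monomials `1, x₁, …, x_d` of `A`. -/
def mono : Option (Fin d) → TruncAlg k d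
  | none => 1
  | some j => Ideal.Quotient.mk _ (MvPolynomial.X j)

/-- The weight of the tensor monomial with factors `mono (v i)`: the number of its factors that
are one of the variables. -/
def monoWeight {r : ℕ} (v : Fin r → Option (Fin d)) : ℕ :=
  (Finset.univ.filter fun i => (v i).isSome).card

/-- The elements of weight `w` of `A^{⊗ r}`: the span of the tensor monomials of weight `w`. -/
def weightPart (r w : ℕ) : Submodule k (⨂[k]^r (TruncAlg k d)) :=
  Submodule.span k
    {y | ∃ v : Fin r → Option (Fin d), monoWeight d v = w ∧
      y = PiTensorProduct.tprod k fun i => mono k d (v i)}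

/-- The weight `w` part of the total complex (in any degree). -/
def totWeight (w : ℕ) : Submodule k (Tot k (TruncAlg k d)) :=
  Submodule.pi Set.univ fun q => weightPart k d (q + 1) w

/-- The cycles of degree `n` of the weight `w` subcomplex. -/
abbrev weightCycles (w : ℕ) (n : ℤ) : Submodule k (Tot k (TruncAlg k d)) :=
  cycles k (TruncAlg k d) n ⊓ totWeight k d w

/-- The boundaries of degree `n` of the weight `w` subcomplex. -/
abbrev weightBoundaries (w : ℕ) (n : ℤ) : Submodule k (Tot k (TruncAlg k d)) :=
  (totWeight k d w).map (totD k (TruncAlg k d) (n + 1))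

/-- `HP^{(w)}_n(A)`, the homology of the weight `w` subcomplex. -/
abbrev HPWeight (w : ℕ) (n : ℤ) : Type u :=
  weightCycles k d w n ⧸ (weightBoundaries k d w n).submoduleOf (weightCycles k d w n)

/-- The map `HP^{(w)}_n(A) ⟶ HP_n(A)` induced by the inclusion of the weight `w` subcomplex. -/
def weightIncl (w : ℕ) (n : ℤ) : HPWeight k d w n →ₗ[k] HP k (TruncAlg k d) n :=
  Submodule.mapQ _ _ (Submodule.inclusion inf_le_left) (by
    rintro x ⟨y, -, hy⟩
    exact ⟨y, hy⟩)

/-- `𝔪̄^{⊗ w}` as a representation of the cyclic group of order `w` over `k`. -/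
abbrev mBarRep (w : ℕ) [NeZero w] : Rep.{u} k (CyclicGroup.{u} w) :=
  Rep.of (X := ⨂[k]^w (mBar k d)) (cycRep k (mBar k d) w)

end Weight

end CyclicHomology

end

/-! Write `A = k ⊕ M` with `M = 𝔪̄` and `M · M = 0`; the homological argument uses nothing else
(`SquareZeroSplitting`). Since `M` is a bimodule through the augmentation, `M ⊗ A^{⊗ *}` is a
subcomplex of the Hochschild complex. Both this subcomplex, up to the factor `M`, and the quotient
by it are the complex `A^{⊗ *}` computing `Tor^A(k, k)` (`hochschild_cons_incl`,
`augHead_hochschild`). An explicit contraction (`torD_torH_succ`) shows that the homology of that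
complex is `M^{⊗ n}` in degree `n`, of weight `n`. So in weight `w > 0` the Hochschild columns are
concentrated, up to homology, on `M ⊗ M^{⊗ w-1}` in simplicial degree `w - 1` and `1 ⊗ M^{⊗ w}` in
degree `w`, and `b` induces `1 - t` between them (`tmap_proj_hochschild`). The bar columns are
contracted by `x ↦ 1 ⊗ x`.

Consequently a cycle of weight `w` vanishing in simplicial degrees below `w` is a boundary as soon
as one obstruction in `M^{⊗ w}` vanishes (`exists_totD_eq`): its entries are killed one at a time,
and the infinite sum of corrections exists because the total complex is a product. The chain map
`toPeriodic` onto the two-periodic complex with differentials `1 - t` and `N` on `M^{⊗ w}` is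
therefore an isomorphism on homology (`nonempty_homology_equiv_periodic`). In weight zero the same
vanishing result leaves one copy of `k` in even degrees.

The product formula holds because `A^{⊗ q+1}` has only the weights `≤ q + 1`: a family with one
element of the total complex in each weight has finite sums in every entry, so cycles and primitives
can be chosen weight by weight (`exists_homology_equiv`). Finally, Tate cohomology of a finite
cyclic group is the homology of the same two-periodic complex (`nonempty_tateCohomology_even_equiv`,
`nonempty_tateCohomology_odd_equiv`). -/

open scoped TensorProduct

noncomputable section

namespace CyclicHomology

universe u

/-! ### Tensor powers: splitting off the first factor, rotation, functoriality. -/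

section Cons

variable (k : Type u) [CommRing k] (M : Type u) [AddCommGroup M] [Module k M]

/-- `a ⊗ x`, as a map `M × M^{⊗ n} ⟶ M^{⊗ n+1}`. -/
def cons (n : ℕ) : M →ₗ[k] (⨂[k]^n M) →ₗ[k] ⨂[k]^(n + 1) M :=
  (PiTensorProduct.lift (R := k) (s := fun _ : Fin n => M)).toLinearMap ∘ₗ
    (PiTensorProduct.tprod k (s := fun _ : Fin (n + 1) => M)).curryLeft

variable {k M}

theorem cons_tprod (n : ℕ) (a : M) (x : Fin n → M) :
    cons k M n a (PiTensorProduct.tprod k x) =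
      PiTensorProduct.tprod k (Fin.cons a x : Fin (n + 1) → M) := by
  simp [cons]

theorem tprod_eq_cons (n : ℕ) (x : Fin (n + 1) → M) :
    PiTensorProduct.tprod k x = cons k M n (x 0) (PiTensorProduct.tprod k (Fin.tail x)) := by
  rw [cons_tprod, Fin.cons_self_tail]

variable {P : Type*} [AddCommGroup P] [Module k P]

theorem tprod_hom_ext {n : ℕ} {f g : (⨂[k]^n M) →ₗ[k] P}
    (h : ∀ x : Fin n → M, f (PiTensorProduct.tprod k x) = g (PiTensorProduct.tprod k x)) :
    f = g := by
  apply PiTensorProduct.ext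
  ext x
  exact h x

theorem snoc_hom_ext {n : ℕ} {f g : (⨂[k]^(n + 1) M) →ₗ[k] P}
    (h : ∀ (x : Fin n → M) (a : M), f (PiTensorProduct.tprod k (Fin.snoc x a : Fin (n + 1) → M)) =
      g (PiTensorProduct.tprod k (Fin.snoc x a : Fin (n + 1) → M))) : f = g := by
  apply tprod_hom_ext
  intro x
  rw [← Fin.snoc_init_self x]
  exact h _ _

theorem cons_hom_ext {n : ℕ} {f g : (⨂[k]^(n + 1) M) →ₗ[k] P}
    (h : ∀ a x, f (cons k M n a x) = g (cons k M n a x)) : f = g := by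
  apply tprod_hom_ext
  intro x
  rw [tprod_eq_cons, h]

/-- The linear map on `M^{⊗ n+1}` with prescribed values on the elements `a ⊗ x`. -/
def consLift {n : ℕ} (g : M →ₗ[k] (⨂[k]^n M) →ₗ[k] P) : (⨂[k]^(n + 1) M) →ₗ[k] P :=
  PiTensorProduct.lift (LinearMap.uncurryLeft (M := fun _ : Fin (n + 1) => M)
    ((PiTensorProduct.lift (R := k) (s := fun _ : Fin n => M)).symm.toLinearMap ∘ₗ g))

theorem consLift_cons {n : ℕ} (g : M →ₗ[k] (⨂[k]^n M) →ₗ[k] P) (a : M) (x : ⨂[k]^n M) :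
    consLift g (cons k M n a x) = g a x := by
  have : consLift g ∘ₗ cons k M n a = g a := by
    apply tprod_hom_ext
    intro x
    simp [cons_tprod, consLift, PiTensorProduct.lift_symm]
  exact LinearMap.congr_fun this x

theorem rotate_snoc (n : ℕ) (x : Fin n → M) (a : M) :
    rotate k M (n + 1) (PiTensorProduct.tprod k (Fin.snoc x a : Fin (n + 1) → M)) =
      PiTensorProduct.tprod k (Fin.cons a x : Fin (n + 1) → M) := by
  rw [rotate_tprod]
  congr 1
  ext i
  obtain ⟨j, rfl⟩ := (finRotate (n + 1)).surjective i
  rw [Equiv.symm_apply_apply]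
  induction j using Fin.lastCases with
  | last => simp
  | cast j => simp

/-- The functoriality of the tensor powers. -/
abbrev tmap {N : Type u} [AddCommGroup N] [Module k N] (n : ℕ) (f : M →ₗ[k] N) :
    (⨂[k]^n M) →ₗ[k] ⨂[k]^n N :=
  PiTensorProduct.map fun _ => f

theorem tmap_cons {N : Type u} [AddCommGroup N] [Module k N] (n : ℕ) (f : M →ₗ[k] N) (a : M)
    (x : ⨂[k]^n M) :
    tmap (n + 1) f (cons k M n a x) = cons k N n (f a) (tmap n f x) := by
  have : tmap (n + 1) f ∘ₗ cons k M n a = cons k N n (f a) ∘ₗ tmap n f := by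
    apply tprod_hom_ext
    intro x
    simp only [LinearMap.comp_apply, cons_tprod, tmap, PiTensorProduct.map_tprod]
    congr 1
    ext i
    induction i using Fin.cases <;> simp
  exact LinearMap.congr_fun this x

theorem tmap_rotate {N : Type u} [AddCommGroup N] [Module k N] (n : ℕ) (f : M →ₗ[k] N)
    (x : ⨂[k]^n M) : tmap n f (rotate k M n x) = rotate k N n (tmap n f x) := by
  have : tmap n f ∘ₗ rotate k M n = rotate k N n ∘ₗ tmap n f := by
    apply tprod_hom_ext
    intro x
    simp only [LinearMap.comp_apply, rotate_tprod, tmap, PiTensorProduct.map_tprod]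
  exact LinearMap.congr_fun this x

theorem tmap_cyc {N : Type u} [AddCommGroup N] [Module k N] (n : ℕ) (f : M →ₗ[k] N)
    (x : ⨂[k]^n M) : tmap n f (cyc k M n x) = cyc k N n (tmap n f x) := by
  simp only [cyc, LinearMap.smul_apply, map_smul, tmap_rotate]

theorem tmap_cyc_pow {N : Type u} [AddCommGroup N] [Module k N] (n : ℕ) (f : M →ₗ[k] N) (j : ℕ)
    (x : ⨂[k]^n M) : tmap n f ((cyc k M n ^ j) x) = (cyc k N n ^ j) (tmap n f x) := by
  induction j generalizing x with
  | zero => rfl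
  | succ j ih => rw [pow_succ, pow_succ, Module.End.mul_apply, Module.End.mul_apply, ih, tmap_cyc]

theorem tmap_cycNorm {N : Type u} [AddCommGroup N] [Module k N] (n : ℕ) (f : M →ₗ[k] N)
    (x : ⨂[k]^n M) : tmap n f (cycNorm k M n x) = cycNorm k N n (tmap n f x) := by
  simp only [cycNorm, LinearMap.sum_apply, map_sum, tmap_cyc_pow]

end Cons

section Sums

variable {R V W X ι : Type*} [CommRing R] [AddCommGroup V] [AddCommGroup W] [AddCommGroup X]
  [Module R V] [Module R W] [Module R X]

theorem sum_comp_linearMap (s : Finset ι) (f : ι → W →ₗ[R] X) (g : V →ₗ[R] W) :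
    (∑ i ∈ s, f i) ∘ₗ g = ∑ i ∈ s, f i ∘ₗ g := by
  ext
  simp

theorem linearMap_comp_sum (s : Finset ι) (f : W →ₗ[R] X) (g : ι → V →ₗ[R] W) :
    f ∘ₗ (∑ i ∈ s, g i) = ∑ i ∈ s, f ∘ₗ g i := by
  ext
  simp

end Sums

/-! ### The operator identities that make the periodic array a bicomplex. -/

section Identities

variable {k : Type u} [CommRing k] {A : Type u} [Ring A] [Algebra k A]

theorem face_tprod (n : ℕ) (i : Fin (n + 1)) (a : Fin (n + 2) → A) :
    face k A n i (PiTensorProduct.tprod k a) =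
      PiTensorProduct.tprod k (Fin.contractNth i.castSucc (· * ·) a) := by
  simp [face]

theorem face_zero_cons (n : ℕ) (a b : A) (x : ⨂[k]^n A) :
    face k A n 0 (cons k A (n + 1) a (cons k A n b x)) = cons k A n (a * b) x := by
  have : face k A n 0 ∘ₗ cons k A (n + 1) a ∘ₗ cons k A n b = cons k A n (a * b) := by
    apply tprod_hom_ext
    intro x
    simp only [LinearMap.comp_apply, cons_tprod, face_tprod]
    congr 1
    ext i
    induction i using Fin.cases with
    | zero => simp [Fin.contractNth]
    | succ i => simp [Fin.contractNth]
  exact LinearMap.congr_fun this x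

theorem face_succ_cons (n : ℕ) (i : Fin (n + 1)) (a : A) (x : ⨂[k]^(n + 2) A) :
    face k A (n + 1) i.succ (cons k A (n + 2) a x) = cons k A (n + 1) a (face k A n i x) := by
  have : face k A (n + 1) i.succ ∘ₗ cons k A (n + 2) a = cons k A (n + 1) a ∘ₗ face k A n i := by
    apply tprod_hom_ext
    intro x
    simp only [LinearMap.comp_apply, cons_tprod, face_tprod]
    congr 1
    ext j
    induction j using Fin.cases with
    | zero => simp [Fin.contractNth]
    | succ j => simp [Fin.contractNth]
  exact LinearMap.congr_fun this x

theorem face_castSucc_snoc (n : ℕ) (i : Fin (n + 1)) (x : Fin (n + 2) → A) (a : A) :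
    face k A (n + 1) i.castSucc (PiTensorProduct.tprod k (Fin.snoc x a : Fin (n + 3) → A)) =
      PiTensorProduct.tprod k
        (Fin.snoc (Fin.contractNth i.castSucc (· * ·) x) a : Fin (n + 2) → A) := by
  rw [face_tprod]
  congr 1
  ext j
  simp only [Fin.contractNth, Fin.snoc, Fin.castLT, Fin.castSucc, Fin.castAdd, Fin.castLE, Fin.succ,
    cast_eq]
  grind

theorem face_last_snoc (n : ℕ) (x : Fin n → A) (a b : A) :
    face k A n (Fin.last n) (PiTensorProduct.tprod k
        (Fin.snoc (Fin.snoc x a : Fin (n + 1) → A) b : Fin (n + 2) → A)) =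
      PiTensorProduct.tprod k (Fin.snoc x (a * b) : Fin (n + 1) → A) := by
  rw [face_tprod]
  congr 1
  ext j
  simp only [Fin.contractNth, Fin.snoc, Fin.castLT, Fin.castSucc, Fin.castAdd, Fin.castLE, Fin.succ,
    cast_eq, Fin.val_last]
  grind

theorem rotate_face (n : ℕ) (i : Fin (n + 1)) :
    rotate k A (n + 2) ∘ₗ face k A (n + 1) i.castSucc =
      face k A (n + 1) i.succ ∘ₗ rotate k A (n + 3) := by
  apply snoc_hom_ext
  intro x a
  rw [LinearMap.comp_apply, LinearMap.comp_apply, face_castSucc_snoc, rotate_snoc, rotate_snoc,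
    ← cons_tprod, ← cons_tprod, face_succ_cons, face_tprod]

theorem rotate_face_last (n : ℕ) :
    rotate k A (n + 1) ∘ₗ face k A n (Fin.last n) =
      face k A n 0 ∘ₗ (rotate k A (n + 2) ∘ₗ rotate k A (n + 2)) := by
  apply snoc_hom_ext
  intro x b
  rw [← Fin.snoc_init_self x]
  simp only [LinearMap.comp_apply]
  rw [face_last_snoc, rotate_snoc, rotate_snoc, Fin.cons_snoc_eq_snoc_cons, rotate_snoc,
    ← cons_tprod, ← cons_tprod, ← cons_tprod, face_zero_cons]

theorem face_zero_face_succ (n : ℕ) (i : Fin (n + 1)) :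
    face k A n 0 ∘ₗ face k A (n + 1) i.succ = face k A n i ∘ₗ face k A (n + 1) 0 := by
  apply tprod_hom_ext
  intro x
  rw [tprod_eq_cons, tprod_eq_cons]
  simp only [LinearMap.comp_apply]
  rw [face_succ_cons, face_zero_cons]
  induction i using Fin.cases with
  | zero =>
    rw [tprod_eq_cons, face_zero_cons, face_zero_cons, face_zero_cons, mul_assoc]
  | succ i =>
    obtain _ | n := n
    · exact i.elim0
    · rw [face_succ_cons, face_zero_cons, face_succ_cons]

theorem bar_cons (n : ℕ) (a : A) (x : ⨂[k]^(n + 2) A) :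
    bar k A (n + 1) (cons k A (n + 2) a x) =
      face k A (n + 1) 0 (cons k A (n + 2) a x) - cons k A (n + 1) a (bar k A n x) := by
  simp only [bar, LinearMap.sum_apply, LinearMap.smul_apply, map_sum, map_smul]
  rw [Fin.sum_univ_succ]
  simp [face_succ_cons, pow_succ, sub_eq_add_neg]

theorem bar_zero : bar k A 0 = face k A 0 0 := by
  simp [bar]

theorem bar_comp_bar (n : ℕ) : bar k A n ∘ₗ bar k A (n + 1) = 0 := by
  induction n with
  | zero =>
    apply cons_hom_ext
    intro a x
    simp only [LinearMap.comp_apply, bar_cons, map_sub]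
    rw [bar_zero, ← LinearMap.comp_apply, ← face_zero_face_succ, LinearMap.comp_apply,
      face_succ_cons]
    simp
  | succ n ih =>
    apply cons_hom_ext
    intro a x
    -- This is left `A`-linearity of `b'`, for the action of `a` by multiplication on the first
    -- factor.
    have key : (bar k A (n + 1)) ∘ₗ face k A (n + 2) 0 ∘ₗ cons k A (n + 3) a =
        face k A (n + 1) 0 ∘ₗ cons k A (n + 2) a ∘ₗ bar k A (n + 1) := by
      apply cons_hom_ext
      intro b x
      simp only [LinearMap.comp_apply]
      rw [face_zero_cons, bar_cons, bar_cons, map_sub, map_sub, face_zero_cons]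
      have := LinearMap.congr_fun (face_zero_face_succ (k := k) (A := A) (n + 1) 0)
        (cons k A (n + 3) a (cons k A (n + 2) b x))
      simp only [LinearMap.comp_apply] at this
      rw [face_succ_cons, face_zero_cons] at this
      rw [this]
    have h := LinearMap.congr_fun ih x
    simp only [LinearMap.comp_apply, LinearMap.zero_apply] at h
    rw [LinearMap.comp_apply, bar_cons, map_sub, bar_cons, h]
    have := LinearMap.congr_fun key x
    simp only [LinearMap.comp_apply] at this
    rw [this]
    simp

theorem lastFace_face_castSucc (n : ℕ) (i : Fin (n + 1)) :
    lastFace k A n ∘ₗ face k A (n + 1) i.castSucc = face k A n i ∘ₗ lastFace k A (n + 1) := by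
  rw [lastFace, LinearMap.comp_assoc, rotate_face, ← LinearMap.comp_assoc, face_zero_face_succ,
    LinearMap.comp_assoc, lastFace]

theorem lastFace_face_last (n : ℕ) :
    lastFace k A n ∘ₗ face k A (n + 1) (Fin.last (n + 1)) =
      lastFace k A n ∘ₗ lastFace k A (n + 1) := by
  refine LinearMap.ext fun z => ?_
  have h1 := LinearMap.congr_fun (rotate_face (k := k) (A := A) n 0) (rotate k A (n + 3) z)
  have h2 := LinearMap.congr_fun (rotate_face_last (k := k) (A := A) (n + 1)) z
  have h3 := LinearMap.congr_fun (face_zero_face_succ (k := k) (A := A) n 0)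
    (rotate k A (n + 3) (rotate k A (n + 3) z))
  simp only [LinearMap.comp_apply, Fin.castSucc_zero] at h1 h2 h3
  simp only [lastFace, LinearMap.comp_apply]
  rw [h1, h2, h3]

theorem lastFace_comp_bar (n : ℕ) :
    lastFace k A n ∘ₗ bar k A (n + 1) = bar k A n ∘ₗ lastFace k A (n + 1) +
      (-1 : k) ^ (n + 1) • (lastFace k A n ∘ₗ lastFace k A (n + 1)) := by
  rw [bar, Fin.sum_univ_castSucc, LinearMap.comp_add, LinearMap.comp_smul, lastFace_face_last, bar,
    sum_comp_linearMap, linearMap_comp_sum]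
  simp [LinearMap.comp_smul, LinearMap.smul_comp, lastFace_face_castSucc]

/-- With `l` the last face, `b = b' ± l`. As `l` commutes with every face but the last, where `l
dₙ₊₁ = l l`, the cross terms `l b'` and `b' l` differ by exactly the `l l` that has to be cancelled.
-/
theorem hochschild_comp_hochschild (n : ℕ) : hochschild k A n ∘ₗ hochschild k A (n + 1) = 0 := by
  simp only [hochschild, LinearMap.add_comp, LinearMap.comp_add, LinearMap.smul_comp,
    LinearMap.comp_smul, lastFace_comp_bar, bar_comp_bar, smul_add, smul_smul]
  rw [← pow_add, ← pow_add, Even.neg_one_pow ⟨n + 1, rfl⟩,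
    show n + 1 + 1 + (n + 1) = (n + 1 + (n + 1)) + 1 by ring,
    pow_succ _ (n + 1 + (n + 1)), pow_succ _ (n + 1),
    Even.neg_one_pow ⟨n + 1, rfl⟩]
  module

theorem face_comp_rotate_pow (n : ℕ) (i : ℕ) (hi : i < n + 1) :
    face k A n ⟨i, hi⟩ ∘ₗ (rotate k A (n + 2) ^ i) = (rotate k A (n + 1) ^ i) ∘ₗ face k A n 0 := by
  induction i with
  | zero => rfl
  | succ i ih =>
    obtain _ | n := n
    · omega
    have h := rotate_face (k := k) (A := A) n ⟨i, by omega⟩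
    rw [pow_succ', Module.End.mul_eq_comp, ← LinearMap.comp_assoc]
    erw [← h]
    rw [LinearMap.comp_assoc]
    erw [ih (by omega)]
    rw [pow_succ', Module.End.mul_eq_comp, LinearMap.comp_assoc]

theorem cyc_pow_comp_face (n : ℕ) (i : ℕ) (hi : i < n + 1) :
    (cyc k A (n + 1) ^ i) ∘ₗ face k A n 0 =
      ((-1 : k) ^ i • face k A n ⟨i, hi⟩) ∘ₗ (cyc k A (n + 2) ^ i) := by
  simp only [cyc, smul_pow, LinearMap.smul_comp, LinearMap.comp_smul, face_comp_rotate_pow,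
    smul_smul]
  rw [← pow_mul, ← pow_mul, ← pow_add]
  congr 1
  rw [show (n + 2 - 1) * i + i = 2 * i + (n + 1 - 1) * i by simp; ring, pow_add, pow_mul]
  simp

/-- Each signed face is `tⁱ d₀ t⁻ⁱ`, the sign in `t` accounting for `(-1)ⁱ`; the inverse is written
`t^(n+2-i)` because `t^(n+2) = 1` on `A^{⊗ n+2}`. The identities between `b`, `b'`, `t` and `N` thus
reduce to sums over `d₀` and powers of `t`. -/
theorem bar_eq_sum (n : ℕ) : bar k A n =
    ∑ i ∈ Finset.range (n + 1),
      (cyc k A (n + 1) ^ i) ∘ₗ face k A n 0 ∘ₗ (cyc k A (n + 2) ^ (n + 2 - i)) := by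
  rw [bar, ← Fin.sum_univ_eq_sum_range (fun i =>
    (cyc k A (n + 1) ^ i) ∘ₗ face k A n 0 ∘ₗ (cyc k A (n + 2) ^ (n + 2 - i)))]
  refine Finset.sum_congr rfl fun i _ => ?_
  rw [← LinearMap.comp_assoc, cyc_pow_comp_face n i i.2, LinearMap.comp_assoc,
    ← Module.End.mul_eq_comp, ← pow_add, Nat.add_sub_cancel' (by omega), cyc_pow_self]
  rfl

theorem hochschild_eq_bar_add (n : ℕ) :
    hochschild k A n = bar k A n + face k A n 0 ∘ₗ cyc k A (n + 2) := by
  rw [hochschild, lastFace, cyc, LinearMap.comp_smul]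
  rfl

theorem hochschild_eq_sum (n : ℕ) : hochschild k A n =
    ∑ i ∈ Finset.range (n + 2),
      (cyc k A (n + 1) ^ i) ∘ₗ face k A n 0 ∘ₗ (cyc k A (n + 2) ^ (n + 2 - i)) := by
  rw [Finset.sum_range_succ, ← bar_eq_sum, cyc_pow_self, hochschild_eq_bar_add,
    show n + 2 - (n + 1) = 1 by omega, pow_one]
  rfl

/-- In the conjugation sums, `b' t` and `t b'` agree after shifting the index by one; the two extra
summands are the unmatched end terms. Stated additively, this is `b (1 - t) = (1 - t) b'` with `b =
b' + d₀ t`. -/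
theorem bar_comp_cyc (n : ℕ) :
    bar k A n ∘ₗ cyc k A (n + 2) + face k A n 0 ∘ₗ (cyc k A (n + 2) ^ 2) =
    cyc k A (n + 1) ∘ₗ bar k A n + face k A n 0 ∘ₗ cyc k A (n + 2) := by
  rw [bar_eq_sum, sum_comp_linearMap, linearMap_comp_sum, Finset.sum_range_succ' _ n,
    Finset.sum_range_succ _ n]
  have h1 : ∀ i ∈ Finset.range n, ((cyc k A (n + 1) ^ (i + 1)) ∘ₗ face k A n 0 ∘ₗ
      (cyc k A (n + 2) ^ (n + 2 - (i + 1)))) ∘ₗ cyc k A (n + 2) = cyc k A (n + 1) ∘ₗ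
        (cyc k A (n + 1) ^ i) ∘ₗ face k A n 0 ∘ₗ (cyc k A (n + 2) ^ (n + 2 - i)) := by
    intro i hi
    rw [Finset.mem_range] at hi
    rw [show n + 2 - i = n + 2 - (i + 1) + 1 by omega, pow_succ', pow_succ (cyc k A (n + 2)),
      Module.End.mul_eq_comp, Module.End.mul_eq_comp]
    simp only [LinearMap.comp_assoc]
  rw [Finset.sum_congr rfl h1]
  have h2 : cyc k A (n + 1) ∘ₗ (cyc k A (n + 1) ^ n) = 1 := by
    rw [← Module.End.mul_eq_comp, ← pow_succ', cyc_pow_self]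
  rw [← LinearMap.comp_assoc _ _ (cyc k A (n + 1)), h2, Nat.sub_zero, cyc_pow_self,
    show n + 2 - n = 2 by omega]
  simp only [pow_zero, Module.End.one_eq_id, LinearMap.id_comp, LinearMap.comp_id]
  abel

theorem hochschild_comp_oneSubCyc (n : ℕ) :
    hochschild k A n ∘ₗ oneSubCyc k A (n + 2) = oneSubCyc k A (n + 1) ∘ₗ bar k A n := by
  have h := bar_comp_cyc (k := k) (A := A) n
  rw [hochschild_eq_bar_add]
  simp only [oneSubCyc, LinearMap.comp_sub, LinearMap.sub_comp, LinearMap.add_comp,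
    Module.End.one_eq_id, LinearMap.id_comp, LinearMap.comp_id, LinearMap.comp_assoc]
  rw [← Module.End.mul_eq_comp (cyc k A (n + 2)), ← pow_two, h]
  abel

theorem cyc_pow_mul_cycNorm (M : Type u) [AddCommGroup M] [Module k M] (n i : ℕ) :
    cyc k M n ^ i * cycNorm k M n = cycNorm k M n := by
  have h := one_sub_cyc_mul_cycNorm k M n
  rw [sub_mul, one_mul, sub_eq_zero] at h
  induction i with
  | zero => rw [pow_zero, one_mul]
  | succ i ih => rw [pow_succ, mul_assoc, ← h, ih]

theorem cycNorm_mul_cyc_pow (M : Type u) [AddCommGroup M] [Module k M] (n i : ℕ) :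
    cycNorm k M n * cyc k M n ^ i = cycNorm k M n := by
  have h := cycNorm_mul_one_sub_cyc k M n
  rw [mul_sub, mul_one, sub_eq_zero] at h
  induction i with
  | zero => rw [pow_zero, mul_one]
  | succ i ih => rw [pow_succ', ← mul_assoc, ← h, ih]

/-- Both sides equal `N d₀ N`: the norm absorbs the powers of `t` next to it, and the remaining
powers of `t` sum to the other norm. -/
theorem bar_comp_cycNorm (n : ℕ) :
    bar k A n ∘ₗ cycNorm k A (n + 2) = cycNorm k A (n + 1) ∘ₗ hochschild k A n := by
  rw [bar_eq_sum, hochschild_eq_sum, sum_comp_linearMap, linearMap_comp_sum]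
  have h1 : ∀ i ∈ Finset.range (n + 1), ((cyc k A (n + 1) ^ i) ∘ₗ face k A n 0 ∘ₗ
      (cyc k A (n + 2) ^ (n + 2 - i))) ∘ₗ cycNorm k A (n + 2) =
        (cyc k A (n + 1) ^ i) ∘ₗ face k A n 0 ∘ₗ cycNorm k A (n + 2) := by
    intro i _
    rw [LinearMap.comp_assoc, LinearMap.comp_assoc, ← Module.End.mul_eq_comp (cyc k A (n + 2) ^ _),
      cyc_pow_mul_cycNorm]
  have h2 : ∀ i ∈ Finset.range (n + 2), cycNorm k A (n + 1) ∘ₗ ((cyc k A (n + 1) ^ i) ∘ₗ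
      face k A n 0 ∘ₗ (cyc k A (n + 2) ^ (n + 2 - i))) =
        cycNorm k A (n + 1) ∘ₗ face k A n 0 ∘ₗ (cyc k A (n + 2) ^ (n + 2 - i)) := by
    intro i _
    rw [← LinearMap.comp_assoc, ← Module.End.mul_eq_comp (cycNorm k A (n + 1)),
      cycNorm_mul_cyc_pow]
  -- The exponents run over `1, …, n + 2` instead of `0, …, n + 1`; `t^(n+2) = t^0` repairs the
  -- shift.
  have h3 : ∑ i ∈ Finset.range (n + 2), cyc k A (n + 2) ^ (n + 2 - i) = cycNorm k A (n + 2) := by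
    have : ∀ i ∈ Finset.range (n + 2), cyc k A (n + 2) ^ (n + 2 - i) =
        cyc k A (n + 2) ^ (n + 2 - 1 - i + 1) := by
      intro i hi
      rw [Finset.mem_range] at hi
      congr 1
      omega
    rw [Finset.sum_congr rfl this,
      Finset.sum_range_reflect (fun i => cyc k A (n + 2) ^ (i + 1)), Finset.sum_range_succ,
      cyc_pow_self, cycNorm, Finset.sum_range_succ' (fun i => cyc k A (n + 2) ^ i), pow_zero]
  rw [Finset.sum_congr rfl h1, Finset.sum_congr rfl h2, ← sum_comp_linearMap, ← linearMap_comp_sum,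
    ← linearMap_comp_sum, h3, cycNorm, cycNorm]

theorem totD_comp_totD (n : ℤ) : totD k A (n - 1) ∘ₗ totD k A n = 0 := by
  ext z q : 2
  have e1 : n - 1 - ((q : ℤ) + 1) = n - q - 2 := by ring
  have e2 : n - ((q : ℤ) + 1 + 1) = n - q - 2 := by ring
  have e3 : n - 1 - (q : ℤ) = n - q - 1 := by ring
  have e4 : n - ((q : ℤ) + 1) = n - q - 1 := by ring
  simp only [totD, LinearMap.comp_apply, LinearMap.pi_apply, LinearMap.add_apply,
    LinearMap.proj_apply, map_add, Nat.cast_add, Nat.cast_one, e1, e2, e3, e4, LinearMap.zero_apply,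
    Pi.zero_apply]
  rcases Int.even_or_odd (n - q) with h | h
  · have h1 : ¬ Even (n - q - 1) := by grind
    have h2 : Even (n - q - 2) := by grind
    simp only [vert, horiz, h, h1, h2, if_true, if_false]
    have a1 := LinearMap.congr_fun (hochschild_comp_hochschild (k := k) (A := A) q) (z (q + 1 + 1))
    have a2 := LinearMap.congr_fun (hochschild_comp_oneSubCyc (k := k) (A := A) q) (z (q + 1))
    have a3 := LinearMap.congr_fun (one_sub_cyc_mul_cycNorm k A (q + 1)) (z q)
    simp only [LinearMap.comp_apply, LinearMap.zero_apply, Module.End.mul_apply] at a1 a2 a3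
    rw [a1, a2, a3, LinearMap.neg_apply, map_neg]
    abel
  · have h1 : Even (n - q - 1) := by grind
    have h2 : ¬ Even (n - q - 2) := by grind
    have h0 : ¬ Even (n - q) := by grind
    simp only [vert, horiz, h0, h1, h2, if_true, if_false]
    have a1 := LinearMap.congr_fun (bar_comp_bar (k := k) (A := A) q) (z (q + 1 + 1))
    have a2 := LinearMap.congr_fun (bar_comp_cycNorm (k := k) (A := A) q) (z (q + 1))
    have a3 := LinearMap.congr_fun (cycNorm_mul_one_sub_cyc k A (q + 1)) (z q)
    simp only [LinearMap.comp_apply, LinearMap.zero_apply, Module.End.mul_apply] at a1 a2 a3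
    simp only [LinearMap.neg_apply, map_neg]
    rw [a1, a2, a3]
    abel

end Identities

/-! ### Hochschild chains of a square-zero extension and the complex of `Tor^A(k, k)`. -/

/-- A splitting `A = k ⊕ M` of an algebra as a trivial square-zero extension of `k` by a module. -/
structure SquareZeroSplitting (k : Type u) [CommRing k] (A M : Type u) [Ring A] [Algebra k A]
    [AddCommGroup M] [Module k M] where
  /-- The projection onto `k`. -/
  aug : A →ₐ[k] k
  /-- The inclusion of `M`. -/
  incl : M →ₗ[k] A
  /-- The projection onto `M`. -/
  proj : A →ₗ[k] M
  eq_aug_add_incl : ∀ a, a = aug a • 1 + incl (proj a)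
  aug_incl : ∀ y, aug (incl y) = 0
  proj_incl : ∀ y, proj (incl y) = y
  proj_one : proj 1 = 0
  incl_mul_incl : ∀ y z, incl y * incl z = 0

namespace SquareZeroSplitting

variable {k : Type u} [CommRing k] {A M : Type u} [Ring A] [Algebra k A] [AddCommGroup M]
  [Module k M] (S : SquareZeroSplitting k A M)

theorem mul_eq_aug (a b : A) :
    a * b = S.aug a • b + S.aug b • S.incl (S.proj a) := by
  conv_lhs => rw [S.eq_aug_add_incl a, S.eq_aug_add_incl b]
  conv_rhs => enter [1]; rw [S.eq_aug_add_incl b]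
  simp only [add_mul, mul_add, smul_mul_assoc, one_mul, mul_smul_comm, mul_one, S.incl_mul_incl,
    add_zero, smul_add]
  module

theorem split_hom_ext {P : Type*} [AddCommGroup P] [Module k P] {n : ℕ}
    {f g : (⨂[k]^(n + 1) A) →ₗ[k] P}
    (h1 : ∀ x, f (cons k _ n 1 x) = g (cons k _ n 1 x))
    (h2 : ∀ y x, f (cons k _ n (S.incl y) x) = g (cons k _ n (S.incl y) x)) : f = g := by
  apply cons_hom_ext
  intro a x
  rw [S.eq_aug_add_incl a]
  simp only [map_add, map_smul, LinearMap.add_apply, LinearMap.smul_apply, h1, h2]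

/-- The augmentation on the first factor, `a₀ ⊗ x ↦ ε(a₀) x`. -/
def augHead (n : ℕ) : (⨂[k]^(n + 1) A) →ₗ[k] ⨂[k]^n A :=
  consLift ((LinearMap.lsmul k _).flip.flip ∘ₗ (S.aug).toLinearMap)

/-- The boundary of the complex computing `Tor^A(k, k)`: the alternating sum of the maps
multiplying adjacent factors, and of the augmentations on the first and the last factor. -/
def torD : ∀ n : ℕ, (⨂[k]^(n + 1) A) →ₗ[k] ⨂[k]^n A
  | 0 => 0
  -- The recursion `a ⊗ b ⊗ x ↦ ε(a)ε(b) 1 ⊗ x - a ⊗ ∂(b ⊗ x)` is the alternating sum because `ε(a)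
  -- b - ab + ε(b) a = ε(a)ε(b) 1` when `M · M = 0`. The usual formula is recovered in `torD_eq`.
  | n + 1 => consLift
      (LinearMap.lcomp k _ (S.augHead n) ∘ₗ
        (cons k _ n ∘ₗ (S.aug).toLinearMap.smulRight (1 : A)) + (-1 : k) •
      LinearMap.lcomp k _ (torD n) ∘ₗ cons k _ n)

/-- The contraction of the degenerate part of the complex computing `Tor^A(k, k)`: it adds a
factor `1` in front of the first factor `1`. -/
def torH : ∀ n : ℕ, (⨂[k]^n A) →ₗ[k] ⨂[k]^(n + 1) A
  | 0 => 0
  | n + 1 => consLift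
      (LinearMap.compRight k (cons k _ (n + 1) 1) ∘ₗ
        (cons k _ n ∘ₗ (S.aug).toLinearMap.smulRight (1 : A)) + (-1 : k) •
      LinearMap.lcomp k _ (torH n) ∘ₗ cons k _ (n + 1) ∘ₗ S.incl ∘ₗ S.proj)

/-- The contraction `torH` applied behind the first factor, which is projected to `𝔪 / 𝔪²`. -/
def tailH (n : ℕ) :
    (⨂[k]^(n + 1) A) →ₗ[k] ⨂[k]^(n + 2) A :=
  consLift (LinearMap.lcomp k _ (S.torH n) ∘ₗ cons k _ (n + 1) ∘ₗ S.incl ∘ₗ S.proj)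

variable (n : ℕ) (a : A) (y : M)

theorem augHead_cons (x : ⨂[k]^n A) :
    S.augHead n (cons k _ n a x) = S.aug a • x := by
  simp [augHead, consLift_cons]

theorem torD_zero : S.torD 0 = 0 := rfl

theorem torD_cons (x : ⨂[k]^(n + 1) A) :
    S.torD (n + 1) (cons k _ (n + 1) a x) =
      S.aug a • cons k _ n 1 (S.augHead n x) - cons k _ n a (S.torD n x) := by
  simp [torD, consLift_cons, sub_eq_add_neg]

theorem torH_zero : S.torH 0 = 0 := rfl

theorem torH_cons (x : ⨂[k]^n A) :
    S.torH (n + 1) (cons k _ n a x) =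
      S.aug a • cons k _ (n + 1) 1 (cons k _ n 1 x) -
        cons k _ (n + 1) (S.incl (S.proj a)) (S.torH n x) := by
  simp [torH, consLift_cons, sub_eq_add_neg]

theorem tailH_cons (x : ⨂[k]^n A) :
    S.tailH n (cons k _ n a x) = cons k _ (n + 1) (S.incl (S.proj a)) (S.torH n x) := by
  simp [tailH, consLift_cons]

theorem tmap_proj_cons_one (x : ⨂[k]^n A) :
    tmap (n + 1) (S.proj) (cons k _ n 1 x) = 0 := by
  rw [tmap_cons, S.proj_one, map_zero, LinearMap.zero_apply]

theorem tmap_proj_tmap_incl (y : ⨂[k]^n (M)) :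
    tmap n (S.proj) (tmap n (S.incl) y) = y := by
  rw [← LinearMap.comp_apply, ← PiTensorProduct.map_comp]
  have : (fun _ : Fin n => S.proj ∘ₗ S.incl) = fun _ => LinearMap.id := by
    ext _ y : 2
    exact S.proj_incl y
  rw [this, PiTensorProduct.map_id, LinearMap.id_apply]

/-- Every term of the recursive formula for the boundary contains a factor `1`. Hence the retract
`M^{⊗ *}` carries the zero differential. -/
theorem tmap_proj_torD (x : ⨂[k]^(n + 1) A) :
    tmap n (S.proj) (S.torD n x) = 0 := by
  induction n with
  | zero => simp [torD_zero]
  | succ n ih =>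
    have : tmap (n + 1) (S.proj) ∘ₗ S.torD (n + 1) = 0 := by
      apply cons_hom_ext
      intro a x
      rw [LinearMap.comp_apply, torD_cons, map_sub, map_smul, tmap_proj_cons_one, tmap_cons, ih]
      simp
    exact LinearMap.congr_fun this x

theorem torD_torH_zero (x : ⨂[k]^0 A) :
    S.torD 0 (S.torH 0 x) = x - tmap 0 (S.incl) (tmap 0 (S.proj) x) := by
  have : tmap 0 (S.incl) ∘ₗ tmap 0 (S.proj) = LinearMap.id := by
    apply tprod_hom_ext
    intro x
    simp only [LinearMap.comp_apply, tmap, PiTensorProduct.map_tprod, LinearMap.id_apply]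
    congr 1
    exact Subsingleton.elim _ _
  rw [← LinearMap.comp_apply (tmap 0 (S.incl)), this]
  simp [torD_zero]

/-- The complex retracts onto `M^{⊗ *}`, whence `Tor_n^A(k, k) = M^{⊗ n}`. Behind a first factor in
`M` both maps act with a sign, so induction applies; on `1 ⊗ x` the homotopy adds a second `1`, and
all terms but `1 ⊗ x` cancel. -/
theorem torD_torH_succ (x : ⨂[k]^(n + 1) A) :
    S.torD (n + 1) (S.torH (n + 1) x) + S.torH n (S.torD n x) =
      x - tmap (n + 1) (S.incl) (tmap (n + 1) (S.proj) x) := by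
  induction n with
  | zero =>
    have : S.torD 1 ∘ₗ S.torH 1 + S.torH 0 ∘ₗ S.torD 0 =
        LinearMap.id - tmap 1 (S.incl) ∘ₗ tmap 1 (S.proj) := by
      apply S.split_hom_ext
      · intro x
        simp only [LinearMap.add_apply, LinearMap.sub_apply, LinearMap.comp_apply, torH_cons,
          torD_cons, map_sub, map_smul, tmap_proj_cons_one, map_zero, LinearMap.id_apply, map_one,
          S.proj_one, LinearMap.zero_apply, augHead_cons, torD_zero]
        simp
      · intro y x
        simp only [LinearMap.add_apply, LinearMap.sub_apply, LinearMap.comp_apply, torH_cons,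
          torD_cons, map_sub, tmap_cons, map_zero, LinearMap.id_apply, S.aug_incl, S.proj_incl,
          zero_smul, torD_torH_zero]
        simp [torD_zero]
    exact LinearMap.congr_fun this x
  | succ n ih =>
    have : S.torD (n + 2) ∘ₗ S.torH (n + 2) + S.torH (n + 1) ∘ₗ S.torD (n + 1) =
        LinearMap.id - tmap (n + 2) (S.incl) ∘ₗ tmap (n + 2) (S.proj) := by
      apply S.split_hom_ext
      · intro x
        simp only [LinearMap.add_apply, LinearMap.sub_apply, LinearMap.comp_apply, torH_cons,
          torD_cons, map_sub, tmap_proj_cons_one, map_zero, LinearMap.id_apply, map_one, S.proj_one,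
          LinearMap.zero_apply, augHead_cons, one_smul]
        abel
      · intro y x
        simp only [LinearMap.add_apply, LinearMap.sub_apply, LinearMap.comp_apply, torH_cons,
          torD_cons, tmap_cons, LinearMap.id_apply, S.aug_incl, S.proj_incl, zero_smul, zero_sub,
          map_neg, neg_neg]
        rw [← map_add, ih, map_sub]
    exact LinearMap.congr_fun this x

theorem augHead_rotate_cons (x : ⨂[k]^(n + 1) A) :
    S.augHead (n + 1) (rotate k _ (n + 2) (cons k _ (n + 1) a x)) =
      cons k _ n a (S.augHead n (rotate k _ (n + 1) x)) := by
  have : S.augHead (n + 1) ∘ₗ rotate k _ (n + 2) ∘ₗ cons k _ (n + 1) a =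
      cons k _ n a ∘ₗ S.augHead n ∘ₗ rotate k _ (n + 1) := by
    apply snoc_hom_ext
    intro x c
    simp only [LinearMap.comp_apply]
    rw [cons_tprod, Fin.cons_snoc_eq_snoc_cons, rotate_snoc, rotate_snoc, ← cons_tprod,
      ← cons_tprod, ← cons_tprod, augHead_cons, augHead_cons, map_smul]
  exact LinearMap.congr_fun this x

theorem lastFace_cons_one (x : ⨂[k]^(n + 1) A) :
    lastFace k _ n (cons k _ (n + 1) 1 x) = rotate k _ (n + 1) x := by
  have : lastFace k _ n ∘ₗ cons k A (n + 1) 1 = rotate k _ (n + 1) := by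
    apply snoc_hom_ext
    intro x c
    simp only [LinearMap.comp_apply, lastFace]
    rw [cons_tprod, Fin.cons_snoc_eq_snoc_cons, rotate_snoc, rotate_snoc, ← cons_tprod,
      ← cons_tprod, face_zero_cons, mul_one, cons_tprod]
  exact LinearMap.congr_fun this x

theorem lastFace_cons_incl (x : ⨂[k]^(n + 1) A) :
    lastFace k _ n (cons k _ (n + 1) (S.incl y) x) =
      cons k _ n (S.incl y) (S.augHead n (rotate k _ (n + 1) x)) := by
  have : lastFace k _ n ∘ₗ cons k _ (n + 1) (S.incl y) =
      cons k _ n (S.incl y) ∘ₗ S.augHead n ∘ₗ rotate k _ (n + 1) := by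
    apply snoc_hom_ext
    intro x c
    simp only [LinearMap.comp_apply, lastFace]
    rw [cons_tprod, Fin.cons_snoc_eq_snoc_cons, rotate_snoc, rotate_snoc, ← cons_tprod,
      ← cons_tprod, ← cons_tprod, face_zero_cons, augHead_cons, S.mul_eq_aug, S.aug_incl, zero_smul,
      add_zero]
    simp
  exact LinearMap.congr_fun this x

theorem face_zero_cons_incl (x : ⨂[k]^(n + 1) A) :
    face k _ n 0 (cons k _ (n + 1) (S.incl y) x) =
      cons k _ n (S.incl y) (S.augHead n x) := by
  have : face k _ n 0 ∘ₗ cons k _ (n + 1) (S.incl y) =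
      cons k _ n (S.incl y) ∘ₗ S.augHead n := by
    apply cons_hom_ext
    intro c x
    simp only [LinearMap.comp_apply]
    rw [face_zero_cons, augHead_cons, S.mul_eq_aug, S.aug_incl, S.proj_incl]
    simp
  exact LinearMap.congr_fun this x

theorem face_zero_cons_one (x : ⨂[k]^(n + 1) A) :
    face k _ n 0 (cons k _ (n + 1) 1 x) = x := by
  have : face k _ n 0 ∘ₗ cons k A (n + 1) 1 = LinearMap.id := by
    apply cons_hom_ext
    intro c x
    simp only [LinearMap.comp_apply]
    rw [face_zero_cons, one_mul, LinearMap.id_apply]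
  exact LinearMap.congr_fun this x

theorem torD_eq (x : ⨂[k]^(n + 2) A) :
    S.torD (n + 1) x = S.augHead (n + 1) x - bar k _ n x +
      (-1 : k) ^ n • S.augHead (n + 1) (rotate k _ (n + 2) x) := by
  induction n with
  | zero =>
    have : S.torD 1 = S.augHead 1 - bar k _ 0 +
        (-1 : k) ^ 0 • S.augHead 1 ∘ₗ rotate k _ 2 := by
      apply S.split_hom_ext
      · intro x
        simp only [LinearMap.add_apply, LinearMap.sub_apply, LinearMap.smul_apply,
          LinearMap.comp_apply, torD_cons, augHead_rotate_cons, augHead_cons, bar_zero,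
          face_zero_cons_one, torD_zero]
        have : rotate k A 1 = 1 := by simpa using rotate_pow_self k A 1
        simp [this]
      · intro y x
        simp only [LinearMap.add_apply, LinearMap.sub_apply, LinearMap.smul_apply,
          LinearMap.comp_apply, torD_cons, augHead_rotate_cons, augHead_cons, bar_zero,
          face_zero_cons_incl, torD_zero, S.aug_incl]
        have : rotate k A 1 = 1 := by simpa using rotate_pow_self k A 1
        simp [this]
    exact LinearMap.congr_fun this x
  | succ n ih =>
    have : S.torD (n + 2) = S.augHead (n + 2) - bar k _ (n + 1) +
        (-1 : k) ^ (n + 1) • S.augHead (n + 2) ∘ₗ rotate k _ (n + 3) := by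
      apply S.split_hom_ext
      · intro x
        simp only [LinearMap.add_apply, LinearMap.sub_apply, LinearMap.smul_apply,
          LinearMap.comp_apply, torD_cons, augHead_rotate_cons, augHead_cons, bar_cons,
          face_zero_cons_one, map_one, ih, map_add, map_sub, map_smul, pow_succ]
        match_scalars <;> ring
      · intro y x
        simp only [LinearMap.add_apply, LinearMap.sub_apply, LinearMap.smul_apply,
          LinearMap.comp_apply, torD_cons, augHead_rotate_cons, augHead_cons, bar_cons,
          face_zero_cons_incl, S.aug_incl, ih, map_add, map_sub, map_smul, pow_succ]
        match_scalars <;> ring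
    exact LinearMap.congr_fun this x

theorem bar_cons_one (x : ⨂[k]^(n + 2) A) :
    bar k _ (n + 1) (cons k _ (n + 2) 1 x) = x - cons k _ (n + 1) 1 (bar k _ n x) := by
  rw [bar_cons, face_zero_cons_one]

/-- In the first and last faces the neighbour of `y` acts on it through the augmentation, as `M · M
= 0`. So the chains with first factor in `M` form a subcomplex, a copy of `M` tensored with the
complex of `Tor^A(k, k)`. -/
theorem hochschild_cons_incl (x : ⨂[k]^(n + 1) A) :
    hochschild k _ n (cons k _ (n + 1) (S.incl y) x) = cons k _ n (S.incl y) (S.torD n x) := by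
  obtain _ | n := n
  · have : rotate k A 1 = 1 := by simpa using rotate_pow_self k A 1
    rw [hochschild, bar_zero, LinearMap.add_apply, LinearMap.smul_apply, lastFace_cons_incl,
      face_zero_cons_incl, torD_zero, this]
    simp
  · rw [hochschild, LinearMap.add_apply, LinearMap.smul_apply, lastFace_cons_incl, bar_cons,
      face_zero_cons_incl, torD_eq]
    simp only [map_add, map_sub, map_smul, pow_succ]
    match_scalars <;> ring

theorem hochschild_cons_one (x : ⨂[k]^(n + 2) A) :
    hochschild k _ (n + 1) (cons k _ (n + 2) 1 x) =
      x - cons k _ (n + 1) 1 (bar k _ n x) + (-1 : k) ^ n • rotate k _ (n + 2) x := by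
  rw [hochschild, LinearMap.add_apply, LinearMap.smul_apply, lastFace_cons_one, bar_cons_one]
  simp [pow_succ]

theorem hochschild_zero_cons_one (x : ⨂[k]^1 A) :
    hochschild k _ 0 (cons k _ 1 1 x) = 0 := by
  have : rotate k A 1 = 1 := by simpa using rotate_pow_self k A 1
  rw [hochschild, LinearMap.add_apply, LinearMap.smul_apply, lastFace_cons_one, bar_zero,
    face_zero_cons_one, this]
  simp

/-- The quotient by the subcomplex of `hochschild_cons_incl` is again the complex of `Tor^A(k, k)`:
on `1 ⊗ x` the first and last faces become the end terms of `torD_eq`. -/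
theorem augHead_hochschild (x : ⨂[k]^(n + 2) A) :
    S.augHead n (hochschild k _ n x) = S.torD n (S.augHead (n + 1) x) := by
  have : S.augHead n ∘ₗ hochschild k _ n = S.torD n ∘ₗ S.augHead (n + 1) := by
    apply S.split_hom_ext
    · intro x
      obtain _ | n := n
      · simp [LinearMap.comp_apply, hochschild_zero_cons_one, torD_zero]
      · simp only [LinearMap.comp_apply, hochschild_cons_one, augHead_cons, torD_eq, map_add,
          map_sub, map_smul, map_one, one_smul]
    · intro y x
      simp [LinearMap.comp_apply, hochschild_cons_incl, augHead_cons, S.aug_incl]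
  exact LinearMap.congr_fun this x

theorem tmap_proj_augHead_hochschild (x : ⨂[k]^(n + 2) A) :
    tmap n (S.proj) (S.augHead n (hochschild k _ n x)) = 0 := by
  rw [augHead_hochschild, tmap_proj_torD]

/-- This is the source of `1 - t`: of the terms of `b (1 ⊗ x)`, the inner faces keep a factor `1`
and die in `M^{⊗ n+1}`, while the first and last faces give `x` and `-t x`. -/
theorem tmap_proj_hochschild (x : ⨂[k]^(n + 2) A) :
    tmap (n + 1) (S.proj) (hochschild k _ n x) =
      oneSubCyc k _ (n + 1) (tmap (n + 1) (S.proj) (S.augHead (n + 1) x)) := by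
  have : tmap (n + 1) (S.proj) ∘ₗ hochschild k _ n =
      oneSubCyc k _ (n + 1) ∘ₗ tmap (n + 1) (S.proj) ∘ₗ S.augHead (n + 1) := by
    apply S.split_hom_ext
    · intro x
      obtain _ | n := n
      · have : cyc k (M) 1 = 1 := by simpa using cyc_pow_self k (M) 1
        simp [LinearMap.comp_apply, hochschild_zero_cons_one, oneSubCyc, this]
      · simp only [LinearMap.comp_apply, hochschild_cons_one, augHead_cons, map_add,
          map_sub, map_smul, map_one, one_smul, tmap_proj_cons_one, tmap_rotate, oneSubCyc, cyc,
          LinearMap.sub_apply, LinearMap.smul_apply, Module.End.one_apply]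
        rw [show n + 1 + 1 - 1 = n + 1 by omega, pow_succ]
        match_scalars <;> ring
    · intro y x
      simp [LinearMap.comp_apply, hochschild_cons_incl, augHead_cons, S.aug_incl, tmap_cons,
        tmap_proj_torD]
  exact LinearMap.congr_fun this x

/-- Projecting `torD_eq` to `M^{⊗ n+1}` kills its left side and leaves `b'` against the two end
terms. It provides the cancellation that makes `toPeriodic` a chain map. -/
theorem tmap_proj_bar (x : ⨂[k]^(n + 2) A) :
    tmap (n + 1) (S.proj) (bar k _ n x) =
      tmap (n + 1) (S.proj) (S.augHead (n + 1) (oneSubCyc k _ (n + 2) x)) := by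
  have h := tmap_proj_torD S (n + 1) x
  rw [torD_eq, map_add, map_sub, sub_add_eq_add_sub, sub_eq_zero] at h
  rw [← h, oneSubCyc, cyc, LinearMap.sub_apply, LinearMap.smul_apply, Module.End.one_apply, map_sub,
    map_sub, show n + 2 - 1 = n + 1 by omega, pow_succ]
  simp only [map_smul]
  match_scalars <;> ring

theorem eq_cons_one_add (x : ⨂[k]^(n + 1) A) :
    x = cons k _ n 1 (S.augHead n x) +
      consLift (cons k _ n ∘ₗ S.incl ∘ₗ S.proj) x := by
  have : LinearMap.id = cons k _ n 1 ∘ₗ S.augHead n +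
      consLift (cons k _ n ∘ₗ S.incl ∘ₗ S.proj) := by
    apply cons_hom_ext
    intro a x
    simp only [LinearMap.add_apply, LinearMap.comp_apply, augHead_cons, consLift_cons,
      LinearMap.id_apply]
    conv_lhs => rw [S.eq_aug_add_incl a]
    simp
  exact LinearMap.congr_fun this x

/-- The hypothesis places `x` in `M ⊗ A^{⊗ n+1}`, where `b` is the boundary `torD` behind the first
factor and `torD_torH_succ` contracts it. -/
theorem hochschild_tailH (x : ⨂[k]^(n + 2) A) (hx : S.augHead (n + 1) x = 0) :
    hochschild k _ (n + 1) (S.tailH (n + 1) x) + S.tailH n (hochschild k _ n x) =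
      x - tmap (n + 2) (S.incl) (tmap (n + 2) (S.proj) x) := by
  -- `J` is the projection onto `M ⊗ A^{⊗ n+1}` along `1 ⊗ A^{⊗ n+1}`; inserting it turns a
  -- conditional statement into an equality of linear maps.
  let J : Module.End k (⨂[k]^(n + 2) A) :=
    consLift (cons k _ (n + 1) ∘ₗ S.incl ∘ₗ S.proj)
  have hJ : J x = x := by
    conv_rhs => rw [S.eq_cons_one_add (n + 1) x, hx, map_zero, zero_add]
  have : hochschild k _ (n + 1) ∘ₗ S.tailH (n + 1) + S.tailH n ∘ₗ hochschild k _ n ∘ₗ J =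
      J - tmap (n + 2) (S.incl) ∘ₗ tmap (n + 2) (S.proj) := by
    apply S.split_hom_ext
    · intro x
      simp [LinearMap.comp_apply, J, consLift_cons, tailH_cons, S.proj_one, tmap_cons]
    · intro y x
      simp only [LinearMap.add_apply, LinearMap.sub_apply, LinearMap.comp_apply, J, consLift_cons,
        tailH_cons, S.proj_incl, hochschild_cons_incl, tmap_cons]
      rw [← map_add, torD_torH_succ, map_sub]
  have h := LinearMap.congr_fun this x
  simp only [LinearMap.add_apply, LinearMap.sub_apply, LinearMap.comp_apply, hJ] at h
  exact h

end SquareZeroSplitting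

/-! ### The weight grading on words and its compatibility with all the operators. -/

namespace SquareZeroSplitting

/-- The number of letters of a word that are elements of `M`. -/
def wordWeight {M : Type u} {r : ℕ} (c : Fin r → Option M) : ℕ :=
  (Finset.univ.filter fun i => (c i).isSome).card

theorem wordWeight_cons {M : Type u} {r : ℕ} (o : Option M) (c : Fin r → Option M) :
    wordWeight (Fin.cons o c : Fin (r + 1) → Option M) =
      (if o.isSome then 1 else 0) + wordWeight c := by
  simp only [wordWeight, Finset.card_filter, Fin.sum_univ_succ, Fin.cons_zero, Fin.cons_succ]

variable {k : Type u} [CommRing k] {A M : Type u} [Ring A] [Algebra k A] [AddCommGroup M]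
  [Module k M] (S : SquareZeroSplitting k A M)

/-- A letter of a word: the unit of `A`, or an element of `M`. -/
def letter (o : Option M) : A := o.elim 1 S.incl

/-- The part of weight `w` of `A^{⊗ r}`, for the grading with `k` in weight zero and `M` in
weight one. -/
def wt (r w : ℕ) : Submodule k (⨂[k]^r A) :=
  Submodule.span k {z | ∃ c : Fin r → Option M, wordWeight c = w ∧
    z = PiTensorProduct.tprod k fun i => S.letter (c i)}

theorem tprod_letter_cons {r : ℕ} (o : Option M) (c : Fin r → Option M) :
    (PiTensorProduct.tprod k fun i => S.letter ((Fin.cons o c : Fin (r + 1) → Option M) i)) =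
      cons k A r (S.letter o) (PiTensorProduct.tprod k fun i => S.letter (c i)) := by
  rw [cons_tprod]
  congr 1
  ext i
  induction i using Fin.cases <;> simp

theorem tprod_letter_mem {r : ℕ} (c : Fin r → Option M) :
    (PiTensorProduct.tprod k fun i => S.letter (c i)) ∈ S.wt r (wordWeight c) :=
  Submodule.subset_span ⟨c, rfl, rfl⟩

variable {S} {r w n : ℕ}

theorem cons_one_mem {x : ⨂[k]^r A} (hx : x ∈ S.wt r w) : cons k A r 1 x ∈ S.wt (r + 1) w := by
  have : S.wt r w ≤ (S.wt (r + 1) w).comap (cons k A r 1) := by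
    refine Submodule.span_le.2 ?_
    rintro _ ⟨c, hc, rfl⟩
    have h := S.tprod_letter_mem (Fin.cons none c : Fin (r + 1) → Option M)
    rw [tprod_letter_cons, wordWeight_cons, hc] at h
    simpa [letter] using h
  exact this hx

theorem cons_incl_mem {x : ⨂[k]^r A} (hx : x ∈ S.wt r w) (y : M) :
    cons k A r (S.incl y) x ∈ S.wt (r + 1) (w + 1) := by
  have : S.wt r w ≤ (S.wt (r + 1) (w + 1)).comap (cons k A r (S.incl y)) := by
    refine Submodule.span_le.2 ?_
    rintro _ ⟨c, hc, rfl⟩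
    have h := S.tprod_letter_mem (Fin.cons (some y) c : Fin (r + 1) → Option M)
    rw [tprod_letter_cons, wordWeight_cons, hc] at h
    simpa [letter, add_comm] using h
  exact this hx

/-- Induction principle on the first letter of a word. The equation `v + 1 = w` replaces a
subtraction and makes the second case void in weight zero. -/
theorem wt_succ_le {N : Submodule k (⨂[k]^(r + 1) A)}
    (h1 : ∀ x ∈ S.wt r w, cons k A r 1 x ∈ N)
    (h2 : ∀ v y, v + 1 = w → ∀ x ∈ S.wt r v, cons k A r (S.incl y) x ∈ N) :
    S.wt (r + 1) w ≤ N := by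
  refine Submodule.span_le.2 ?_
  rintro _ ⟨c, hc, rfl⟩
  rw [← Fin.cons_self_tail c, tprod_letter_cons]
  rw [← Fin.cons_self_tail c, wordWeight_cons] at hc
  have h := S.tprod_letter_mem (Fin.tail c)
  cases ho : c 0 with
  | none =>
    rw [ho] at hc
    have hc' : wordWeight (Fin.tail c) = w := by simpa using hc
    rw [hc'] at h
    exact h1 _ h
  | some y =>
    rw [ho] at hc
    exact h2 _ y (by simpa [add_comm] using hc) _ h

theorem rotate_mem {x : ⨂[k]^r A} (hx : x ∈ S.wt r w) : rotate k A r x ∈ S.wt r w := by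
  have : S.wt r w ≤ (S.wt r w).comap (rotate k A r) := by
    refine Submodule.span_le.2 ?_
    rintro _ ⟨c, hc, rfl⟩
    rw [SetLike.mem_coe, Submodule.mem_comap, rotate_tprod]
    refine Submodule.subset_span ⟨fun i => c ((finRotate r).symm i), ?_, rfl⟩
    rw [← hc, wordWeight, wordWeight, Finset.card_filter, Finset.card_filter]
    exact Equiv.sum_comp (finRotate r).symm fun i => if (c i).isSome then 1 else 0
  exact this hx

theorem face_zero_mem {x : ⨂[k]^(n + 2) A} (hx : x ∈ S.wt (n + 2) w) :
    face k A n 0 x ∈ S.wt (n + 1) w := by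
  have : S.wt (n + 2) w ≤ (S.wt (n + 1) w).comap (face k A n 0) := by
    apply wt_succ_le
    · intro x hx
      rwa [Submodule.mem_comap, face_zero_cons_one]
    · rintro v y rfl
      intro x hx
      have : S.wt (n + 1) v ≤ (S.wt (n + 1) (v + 1)).comap
          (face k A n 0 ∘ₗ cons k A (n + 1) (S.incl y)) := by
        apply wt_succ_le
        · intro x hx
          rw [Submodule.mem_comap, LinearMap.comp_apply, face_zero_cons, mul_one]
          exact cons_incl_mem hx y
        · intro _ z _ x hx
          rw [Submodule.mem_comap, LinearMap.comp_apply, face_zero_cons, S.incl_mul_incl, map_zero]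
          exact Submodule.zero_mem _
      exact this hx
  exact this hx

theorem bar_mem {x : ⨂[k]^(n + 2) A} (hx : x ∈ S.wt (n + 2) w) :
    bar k A n x ∈ S.wt (n + 1) w := by
  induction n generalizing w with
  | zero => rw [bar_zero]; exact face_zero_mem hx
  | succ n ih =>
    have : S.wt (n + 3) w ≤ (S.wt (n + 2) w).comap (bar k A (n + 1)) := by
      apply wt_succ_le
      · intro x hx
        rw [Submodule.mem_comap, bar_cons]
        exact Submodule.sub_mem _ (face_zero_mem (cons_one_mem hx)) (cons_one_mem (ih hx))
      · rintro v y rfl x hx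
        rw [Submodule.mem_comap, bar_cons]
        exact Submodule.sub_mem _ (face_zero_mem (cons_incl_mem hx y)) (cons_incl_mem (ih hx) y)
    exact this hx

theorem hochschild_mem {x : ⨂[k]^(n + 2) A} (hx : x ∈ S.wt (n + 2) w) :
    hochschild k A n x ∈ S.wt (n + 1) w :=
  Submodule.add_mem _ (bar_mem hx) (Submodule.smul_mem _ _ (face_zero_mem (rotate_mem hx)))

theorem cyc_mem {x : ⨂[k]^r A} (hx : x ∈ S.wt r w) : cyc k A r x ∈ S.wt r w :=
  Submodule.smul_mem _ _ (rotate_mem hx)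

theorem cycNorm_mem {x : ⨂[k]^r A} (hx : x ∈ S.wt r w) : cycNorm k A r x ∈ S.wt r w := by
  rw [cycNorm, LinearMap.sum_apply]
  refine Submodule.sum_mem _ fun j hj => ?_
  clear hj
  induction j with
  | zero => exact hx
  | succ j ih => rw [pow_succ', Module.End.mul_apply]; exact cyc_mem ih

theorem vert_mem {p : ℤ} {x : ⨂[k]^(n + 2) A} (hx : x ∈ S.wt (n + 2) w) :
    vert k A p n x ∈ S.wt (n + 1) w := by
  rw [vert]
  split_ifs
  · exact hochschild_mem hx
  · exact Submodule.neg_mem _ (bar_mem hx)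

theorem horiz_mem {p : ℤ} {x : ⨂[k]^(n + 1) A} (hx : x ∈ S.wt (n + 1) w) :
    horiz k A p n x ∈ S.wt (n + 1) w := by
  rw [horiz]
  split_ifs
  · exact cycNorm_mem hx
  · exact Submodule.sub_mem _ hx (cyc_mem hx)

theorem augHead_mem {x : ⨂[k]^(n + 1) A} (hx : x ∈ S.wt (n + 1) w) :
    S.augHead n x ∈ S.wt n w := by
  have : S.wt (n + 1) w ≤ (S.wt n w).comap (S.augHead n) := by
    apply wt_succ_le
    · intro x hx
      rwa [Submodule.mem_comap, augHead_cons, map_one, one_smul]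
    · intro v y _ x _
      rw [Submodule.mem_comap, augHead_cons, S.aug_incl, zero_smul]
      exact Submodule.zero_mem _
  exact this hx

theorem torH_mem {x : ⨂[k]^n A} (hx : x ∈ S.wt n w) : S.torH n x ∈ S.wt (n + 1) w := by
  induction n generalizing w with
  | zero => rw [torH_zero]; exact Submodule.zero_mem _
  | succ n ih =>
    have : S.wt (n + 1) w ≤ (S.wt (n + 2) w).comap (S.torH (n + 1)) := by
      apply wt_succ_le
      · intro x hx
        rw [Submodule.mem_comap, torH_cons, S.proj_one, map_one, one_smul, map_zero, map_zero,
          LinearMap.zero_apply, sub_zero]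
        exact cons_one_mem (cons_one_mem hx)
      · rintro v y rfl x hx
        rw [Submodule.mem_comap, torH_cons, S.aug_incl, zero_smul, zero_sub, S.proj_incl]
        exact Submodule.neg_mem _ (cons_incl_mem (ih hx) y)
    exact this hx

theorem tailH_mem {x : ⨂[k]^(n + 1) A} (hx : x ∈ S.wt (n + 1) w) :
    S.tailH n x ∈ S.wt (n + 2) w := by
  have : S.wt (n + 1) w ≤ (S.wt (n + 2) w).comap (S.tailH n) := by
    apply wt_succ_le
    · intro x hx
      rw [Submodule.mem_comap, tailH_cons, S.proj_one, map_zero, map_zero, LinearMap.zero_apply]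
      exact Submodule.zero_mem _
    · rintro v y rfl x hx
      rw [Submodule.mem_comap, tailH_cons, S.proj_incl]
      exact cons_incl_mem (torH_mem hx) y
  exact this hx

theorem wt_eq_bot (h : r < w) : S.wt r w = ⊥ := by
  rw [eq_bot_iff]
  refine Submodule.span_le.2 ?_
  rintro _ ⟨c, hc, rfl⟩
  have : wordWeight c ≤ r := (Finset.card_le_univ _).trans (by simp)
  omega

theorem eq_zero_of_mem_wt {x : ⨂[k]^r A} (hx : x ∈ S.wt r w) (h : r < w) : x = 0 := by
  rwa [wt_eq_bot h, Submodule.mem_bot] at hx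

/-- A word with fewer letters from `M` than factors contains a `1`, which `proj` kills. This removes
every obstruction except in the critical degree. -/
theorem tmap_proj_eq_zero {x : ⨂[k]^r A} (hx : x ∈ S.wt r w) (h : w < r) :
    tmap r S.proj x = 0 := by
  induction r generalizing w with
  | zero => omega
  | succ r ih =>
    have : S.wt (r + 1) w ≤ LinearMap.ker (tmap (r + 1) S.proj) := by
      apply wt_succ_le
      · intro x _
        rw [LinearMap.mem_ker, tmap_proj_cons_one]
      · rintro v y rfl x hx
        rw [LinearMap.mem_ker, tmap_cons, ih hx (by omega), map_zero]
    exact this hx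

theorem tmap_incl_mem (y : ⨂[k]^r M) : tmap r S.incl y ∈ S.wt r r := by
  have : (⊤ : Submodule k (⨂[k]^r M)) ≤ (S.wt r r).comap (tmap r S.incl) := by
    rw [← PiTensorProduct.span_tprod_eq_top, Submodule.span_le]
    rintro _ ⟨y, rfl⟩
    rw [SetLike.mem_coe, Submodule.mem_comap, tmap, PiTensorProduct.map_tprod]
    have h := S.tprod_letter_mem fun i => some (y i)
    rwa [show wordWeight (fun i => some (y i)) = r by simp [wordWeight]] at h
  exact this trivial

theorem tmap_incl_tmap_proj {x : ⨂[k]^r A} (hx : x ∈ S.wt r r) :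
    tmap r S.incl (tmap r S.proj x) = x := by
  induction r with
  | zero =>
    have h := S.torD_torH_zero x
    rw [torD_zero, LinearMap.zero_apply] at h
    exact (sub_eq_zero.1 h.symm).symm
  | succ r ih =>
    have : S.wt (r + 1) (r + 1) ≤ LinearMap.eqLocus
        (tmap (r + 1) S.incl ∘ₗ tmap (r + 1) S.proj) LinearMap.id := by
      apply wt_succ_le
      · intro x hx
        rw [eq_zero_of_mem_wt hx (by omega), map_zero]
        exact Submodule.zero_mem _
      · intro v y hv x hx
        obtain rfl : v = r := by omega
        rw [LinearMap.mem_eqLocus, LinearMap.comp_apply, tmap_cons, tmap_cons, S.proj_incl, ih hx,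
          LinearMap.id_apply]
    exact this hx

/-- The image of `z` in the quotient complex bounds by the vanishing of its class in `M^{⊗ n+1}`;
lifting its primitive with a first factor `1` leaves a cycle of the subcomplex `M ⊗ A^{⊗ *}`. The
class of the latter lies in `M^{⊗ n+2}`, which has weight `n + 2 > w`. -/
theorem exists_hochschild_eq {z : ⨂[k]^(n + 2) A} (hz : z ∈ S.wt (n + 2) w) (hw : w ≤ n + 1)
    (hb : hochschild k A n z = 0) (h : tmap (n + 1) S.proj (S.augHead (n + 1) z) = 0) :
    ∃ v ∈ S.wt (n + 3) w, hochschild k A (n + 1) v = z := by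
  set α := S.augHead (n + 1) z with hα
  have hαm : α ∈ S.wt (n + 1) w := augHead_mem hz
  have h1 : S.torD (n + 1) (S.torH (n + 1) α) = α := by
    have := S.torD_torH_succ n α
    rwa [h, hα, ← augHead_hochschild, hb, map_zero, map_zero, map_zero, add_zero, sub_zero,
      ← hα] at this
  set v := cons k A (n + 2) 1 (S.torH (n + 1) α) with hv
  have hvm : v ∈ S.wt (n + 3) w := cons_one_mem (torH_mem hαm)
  set z' := z - hochschild k A (n + 1) v with hz'
  have hz'm : z' ∈ S.wt (n + 2) w := Submodule.sub_mem _ hz (hochschild_mem hvm)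
  have h2 : S.augHead (n + 1) z' = 0 := by
    rw [hz', map_sub, augHead_hochschild, hv, augHead_cons, map_one, one_smul, h1, sub_self]
  have h3 : hochschild k A n z' = 0 := by
    rw [hz', map_sub, hb, ← LinearMap.comp_apply, hochschild_comp_hochschild,
      LinearMap.zero_apply, sub_zero]
  have h4 := S.hochschild_tailH n z' h2
  rw [h3, map_zero, add_zero, tmap_proj_eq_zero hz'm (by omega), map_zero, sub_zero] at h4
  refine ⟨v + S.tailH (n + 1) z', Submodule.add_mem _ hvm (tailH_mem hz'm), ?_⟩
  rw [map_add, h4, hz']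
  abel

variable (S)

/-- The part of weight `w` of the total complex. -/
def tot (w : ℕ) : Submodule k (Tot k A) := Submodule.pi Set.univ fun q => S.wt (q + 1) w

variable {S}

theorem mem_tot {z : Tot k A} : z ∈ S.tot w ↔ ∀ q, z q ∈ S.wt (q + 1) w := by
  simp [tot]

theorem totD_mem {n : ℤ} {z : Tot k A} (hz : z ∈ S.tot w) : totD k A n z ∈ S.tot w := by
  rw [mem_tot] at hz ⊢
  intro q
  exact Submodule.add_mem _ (vert_mem (hz _)) (horiz_mem (hz _))

theorem totD_apply (n : ℤ) (z : Tot k A) (q : ℕ) :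
    totD k A n z q = vert k A (n - (q + 1)) q (z (q + 1)) + horiz k A (n - q) q (z q) := rfl

theorem single_mem_tot {q : ℕ} {x : ⨂[k]^(q + 1) A} (hx : x ∈ S.wt (q + 1) w) :
    (Pi.single q x : Tot k A) ∈ S.tot w := by
  rw [mem_tot]
  intro j
  rcases eq_or_ne j q with rfl | h
  · rwa [Pi.single_eq_same]
  · rw [Pi.single_eq_of_ne h]
    exact Submodule.zero_mem _

end SquareZeroSplitting

/-! ### Acyclicity of the weight parts above the critical simplicial degree. -/

namespace SquareZeroSplitting

variable {k : Type u} [CommRing k] {A M : Type u} [Ring A] [Algebra k A] [AddCommGroup M]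
  [Module k M] {S : SquareZeroSplitting k A M} {w : ℕ} {n : ℤ}

/-- The lowest nonzero entry of a total cycle is a vertical cycle. Odd columns are contracted by `x
↦ 1 ⊗ x`; in even columns the only obstruction is the class in `M^{⊗ q}`. -/
theorem exists_vert_eq {q : ℕ} (hwq : w ≤ q) {r : Tot k A} (hr : r ∈ S.tot w)
    (hd : totD k A n r = 0) (h0 : ∀ j < q, r j = 0)
    (hobs : Even (n - q) → tmap q S.proj (S.augHead q (r q)) = 0) :
    ∃ v ∈ S.wt (q + 2) w, vert k A (n - q) q v = r q := by
  rw [mem_tot] at hr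
  have hcyc : ∀ j, j + 1 = q → vert k A (n - (j + 1)) j (r (j + 1)) = 0 := by
    rintro j rfl
    have h := congrFun hd j
    rwa [totD_apply, h0 j (Nat.lt_succ_self j), map_zero, add_zero] at h
  by_cases hp : Even (n - q)
  -- In simplicial degree `0` the weight is `0`, and `A` in weight zero is spanned by `1`; the
  -- obstruction is then the whole entry.
  · obtain _ | q := q
    · obtain rfl : w = 0 := by omega
      have h1 := hobs hp
      have h2 := S.tmap_incl_tmap_proj (augHead_mem (hr 0))
      rw [h1, map_zero] at h2
      have h3 : S.wt 1 0 ≤ LinearMap.eqLocus (cons k A 0 1 ∘ₗ S.augHead 0) LinearMap.id := by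
        apply wt_succ_le
        · intro x _
          rw [LinearMap.mem_eqLocus, LinearMap.comp_apply, augHead_cons, map_one S.aug, one_smul,
            LinearMap.id_apply]
        · intro v y hv
          omega
      have h4 := h3 (hr 0)
      rw [LinearMap.mem_eqLocus, LinearMap.comp_apply, ← h2, map_zero, LinearMap.id_apply] at h4
      exact ⟨0, Submodule.zero_mem _, by rw [map_zero, h4]⟩
    · have h1 := hcyc q rfl
      have hp' : Even (n - ((q : ℤ) + 1)) := by simpa using hp
      rw [vert, if_pos hp'] at h1
      rw [vert, if_pos hp]
      exact exists_hochschild_eq (hr _) hwq h1 (hobs hp)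
  · refine ⟨-cons k A (q + 1) 1 (r q), Submodule.neg_mem _ (cons_one_mem (hr q)), ?_⟩
    rw [vert, if_neg hp, LinearMap.neg_apply, map_neg, neg_neg]
    obtain _ | q := q
    · rw [bar_zero, face_zero_cons_one]
    · have h1 := hcyc q rfl
      have hp' : ¬ Even (n - ((q : ℤ) + 1)) := by simpa using hp
      rw [vert, if_neg hp', LinearMap.neg_apply, neg_eq_zero] at h1
      rw [bar_cons_one, h1, map_zero, sub_zero]

theorem exists_sub_totD_single {q : ℕ} (hwq : w ≤ q) {r : Tot k A} (hr : r ∈ S.tot w)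
    (hd : totD k A n r = 0) (h0 : ∀ j < q, r j = 0)
    (hobs : Even (n - q) → tmap q S.proj (S.augHead q (r q)) = 0) :
    ∃ v ∈ S.wt (q + 2) w, ∀ j < q + 1,
      (r - totD k A (n + 1) (Pi.single (q + 1) v : Tot k A)) j = 0 := by
  obtain ⟨v, hv, h⟩ := exists_vert_eq hwq hr hd h0 hobs
  refine ⟨v, hv, fun j hj => ?_⟩
  rw [Pi.sub_apply, totD_apply, Pi.single_eq_of_ne (by omega : j ≠ q + 1), map_zero, add_zero]
  rcases Nat.lt_succ_iff_lt_or_eq.1 hj with hj | rfl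
  · rw [h0 j hj, Pi.single_eq_of_ne (by omega : j + 1 ≠ q + 1), map_zero, sub_zero]
  · rw [Pi.single_eq_same, show n + 1 - ((j : ℤ) + 1) = n - j by ring, h, sub_self]

theorem totD_totD (n : ℤ) (z : Tot k A) : totD k A n (totD k A (n + 1) z) = 0 := by
  have h := LinearMap.congr_fun (totD_comp_totD (k := k) (A := A) (n + 1)) z
  rwa [LinearMap.comp_apply, show n + 1 - 1 = n by ring] at h

/-- A cycle of weight `w` that vanishes in the simplicial degrees below `w` is a boundary, if it
satisfies the only condition in the simplicial degree `w`. -/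
theorem exists_totD_eq {r : Tot k A} (hr : r ∈ S.tot w)
    (hd : totD k A n r = 0) (h0 : ∀ j < w, r j = 0)
    (hobs : Even (n - w) → tmap w S.proj (S.augHead w (r w)) = 0) :
    ∃ z ∈ S.tot w, (∀ j ≤ w, z j = 0) ∧ totD k A (n + 1) z = r := by
  -- The remainders after `m` corrections: cycles of weight `w`, now zero below degree `w + m`,
  -- still meeting the obstruction condition.
  let R (m : ℕ) : Type u := {r : Tot k A // r ∈ S.tot w ∧ totD k A n r = 0 ∧
    (∀ j < w + m, r j = 0) ∧
    (Even (n - (w + m : ℕ)) → tmap (w + m) S.proj (S.augHead (w + m) (r (w + m))) = 0)}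
  have step : ∀ (m : ℕ) (r : R m), ∃ (v : ⨂[k]^(w + m + 1 + 1) A) (r' : R (m + 1)),
      v ∈ S.wt (w + m + 2) w ∧
        r'.1 = r.1 - totD k A (n + 1) (Pi.single (w + m + 1) v : Tot k A) := by
    rintro m ⟨r, hr, hd, h0, hobs⟩
    obtain ⟨v, hv, h⟩ := exists_sub_totD_single (Nat.le_add_right w m) hr hd h0 hobs
    have hm : r - totD k A (n + 1) (Pi.single (w + m + 1) v : Tot k A) ∈ S.tot w :=
      Submodule.sub_mem _ hr (totD_mem (single_mem_tot hv))
    refine ⟨v, ⟨_, hm, ?_, h, fun _ => ?_⟩, hv, rfl⟩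
    · rw [map_sub, hd, totD_totD, sub_zero]
    -- After one correction the obstruction lives in length `w + m + 1 > w` and vanishes for reasons
    -- of weight, so the hypothesis `hobs` is needed only at the start.
    · exact tmap_proj_eq_zero (augHead_mem (mem_tot.1 hm _)) (by omega)
  choose v next hv hnext using step
  let res : ∀ m, R m := fun m => Nat.rec ⟨r, hr, hd, h0, hobs⟩ next m
  have hres : ∀ m, (res (m + 1)).1 = (res m).1 -
      totD k A (n + 1) (Pi.single (w + m + 1) (v m (res m)) : Tot k A) := fun m => hnext m (res m)
  let s : ℕ → Tot k A := fun m =>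
    ∑ i ∈ Finset.range m, (Pi.single (w + i + 1) (v i (res i)) : Tot k A)
  have hs : ∀ m, totD k A (n + 1) (s m) = r - (res m).1 := by
    intro m
    induction m with
    | zero => simp [s, res]
    | succ m ih =>
      simp only [s] at ih ⊢
      rw [Finset.sum_range_succ, map_add, ih, hres]
      abel
  have hsm : ∀ m, s m ∈ S.tot w := fun m =>
    Submodule.sum_mem _ fun i _ => single_mem_tot (hv i (res i))
  -- The `i`-th correction sits in degree `w + i + 1`, so each entry of the partial sums is
  -- eventually constant. The limit exists in the product, with `j`-th entry `s j j`.
  have hstab : ∀ j m, j ≤ w + m → s m j = s j j := by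
    intro j m h
    have key : ∀ m, j ≤ w + m → s (m + 1) j = s m j := by
      intro m h
      simp only [s]
      rw [Finset.sum_range_succ, Pi.add_apply, Pi.single_eq_of_ne (by omega), add_zero]
    have key2 : ∀ i, s (m + i) j = s m j := by
      intro i
      induction i with
      | zero => rfl
      | succ i ih => rw [← add_assoc, key _ (by omega), ih]
    have key3 : ∀ i, s (j + i) j = s j j := by
      intro i
      induction i with
      | zero => rfl
      | succ i ih => rw [← add_assoc, key _ (by omega), ih]
    rw [← key2 j, ← key3 m, add_comm m j]
  refine ⟨fun j => s j j, ?_, fun j hj => ?_, ?_⟩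
  · rw [mem_tot]
    exact fun j => mem_tot.1 (hsm j) j
  · exact (hstab j 0 (by omega)).symm.trans (by simp [s])
  · ext j
    -- The `j`-th entry of the differential involves the entries `j` and `j + 1`; at stage `j + 1`
    -- both have reached their limits and the remainder vanishes there.
    have h := congrFun (hs (j + 1)) j
    rw [Pi.sub_apply, (res (j + 1)).2.2.2.1 j (by omega), sub_zero, totD_apply] at h
    rw [totD_apply, ← hstab j (j + 1) (by omega), h]

/-! ### Positive weight `w = m + 1`: comparison with the two-periodic complex. -/

section Positive

variable (S) (m : ℕ)

/-- The map from the total complex to the two-periodic complex of the cyclic group acting on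
`M^{⊗ m+1}`. -/
def toPeriodic (n : ℤ) : Tot k A →ₗ[k] ⨂[k]^(m + 1) M :=
  -- When degree `m` lies in an even column, its entry gives the Hochschild class in `M ⊗ M^{⊗ m}`.
  -- Otherwise degree `m + 1` does, and gives the class in `1 ⊗ M^{⊗ m+1}`; the entry in degree `m`
  -- is added to obtain a chain map.
  if Even (n - m) then tmap (m + 1) S.proj ∘ₗ LinearMap.proj m
  else tmap (m + 1) S.proj ∘ₗ LinearMap.proj m +
    tmap (m + 1) S.proj ∘ₗ S.augHead (m + 1) ∘ₗ LinearMap.proj (m + 1)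

variable (k M) in
/-- The differential of the two-periodic complex of the cyclic group acting on `M^{⊗ m+1}`. -/
def periodicD (n : ℤ) : Module.End k (⨂[k]^(m + 1) M) :=
  if Even (n - m) then cycNorm k M (m + 1) else oneSubCyc k M (m + 1)

theorem tmap_oneSubCyc {N : Type u} [AddCommGroup N] [Module k N] (r : ℕ) (f : M →ₗ[k] N)
    (x : ⨂[k]^r M) : tmap r f (oneSubCyc k M r x) = oneSubCyc k N r (tmap r f x) := by
  simp only [oneSubCyc, LinearMap.sub_apply, map_sub, Module.End.one_apply, tmap_cyc]

theorem tmap_periodicD (n : ℤ) (x : ⨂[k]^(m + 1) M) :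
    tmap (m + 1) S.incl (periodicD k M m n x) = horiz k A (n - m) m (tmap (m + 1) S.incl x) := by
  rw [periodicD, horiz]
  split_ifs
  · rw [tmap_cycNorm]
  · rw [tmap_oneSubCyc]

/-- For `n - m` even, `1 - t` arises from `b` through `tmap_proj_hochschild` and from the horizontal
map. For `n - m` odd, the terms `-b'` and `1 - t` applied to the entry in degree `m + 1` cancel by
`tmap_proj_bar`, and only `N` on degree `m` remains. -/
theorem toPeriodic_totD (n : ℤ) (z : Tot k A) :
    S.toPeriodic m n (totD k A (n + 1) z) = periodicD k M m (n + 1) (S.toPeriodic m (n + 1) z) := by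
  by_cases h : Even (n - m)
  · have h' : ¬ Even (n + 1 - m) := by grind
    have h'' : Even (n + 1 - ((m : ℤ) + 1)) := by simpa using h
    rw [toPeriodic, if_pos h, toPeriodic, if_neg h', periodicD, if_neg h']
    simp only [LinearMap.comp_apply, LinearMap.add_apply, LinearMap.proj_apply, totD_apply, vert,
      horiz, if_neg h', if_pos h'', map_add, tmap_proj_hochschild, tmap_oneSubCyc]
    abel
  · have h' : Even (n + 1 - m) := by grind
    have h'' : ¬ Even (n + 1 - ((m : ℤ) + 1)) := by simpa using h
    have h3 : Even (n + 1 - (((m + 1 : ℕ) : ℤ) + 1)) := by push_cast; grind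
    have h4 : ¬ Even (n + 1 - ((m + 1 : ℕ) : ℤ)) := by simpa using h
    rw [toPeriodic, if_neg h, toPeriodic, if_pos h', periodicD, if_pos h']
    simp only [LinearMap.comp_apply, LinearMap.add_apply, LinearMap.proj_apply, totD_apply, vert,
      horiz, if_pos h', if_neg h'', if_pos h3, if_neg h4, map_add, tmap_proj_augHead_hochschild,
      tmap_cycNorm, LinearMap.neg_apply, map_neg, tmap_proj_bar]
    abel

theorem eq_zero_of_mem_tot {z : Tot k A} (hz : z ∈ S.tot w) {j : ℕ} (h : j + 1 < w) : z j = 0 :=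
  eq_zero_of_mem_wt (mem_tot.1 hz j) h

variable {S m}

/-- Injectivity on homology. Entries below degree `m` vanish by weight; once the entry in degree `m`
is gone, `exists_totD_eq` applies in weight `m + 1`. -/
theorem exists_totD_eq_of_toPeriodic_eq_zero {z : Tot k A} (hz : z ∈ S.tot (m + 1))
    (hd : totD k A n z = 0) (h : S.toPeriodic m n z = 0) :
    ∃ u ∈ S.tot (m + 1), totD k A (n + 1) u = z := by
  by_cases hp : Even (n - m)
  · rw [toPeriodic, if_pos hp] at h
    have h1 := tmap_incl_tmap_proj (mem_tot.1 hz m)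
    rw [LinearMap.comp_apply, LinearMap.proj_apply] at h
    rw [h, map_zero] at h1
    have hp' : ¬ Even (n - ((m + 1 : ℕ) : ℤ)) := by push_cast; grind
    obtain ⟨u, hu, -, hu'⟩ := exists_totD_eq hz hd (fun j hj => by
      rcases Nat.lt_succ_iff_lt_or_eq.1 hj with hj | rfl
      · exact S.eq_zero_of_mem_tot hz (by omega)
      · exact h1.symm) fun hp'' => absurd hp'' hp'
    exact ⟨u, hu, hu'⟩
  · rw [toPeriodic, if_neg hp] at h
    simp only [LinearMap.add_apply, LinearMap.comp_apply, LinearMap.proj_apply] at h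
    -- Degree `m` lies in a bar column with differential `-b'`, and `b'(1 ⊗ z m) = z m` because
    -- `b'(z m)` would have weight exceeding its length. Subtracting the boundary of `v` therefore
    -- kills the entry.
    let v : ⨂[k]^(m + 2) A := -cons k A (m + 1) 1 (z m)
    have hv : v ∈ S.wt (m + 2) (m + 1) := Submodule.neg_mem _ (cons_one_mem (mem_tot.1 hz m))
    let u₀ : Tot k A := Pi.single (m + 1) v
    have hu₀ : u₀ ∈ S.tot (m + 1) := single_mem_tot hv
    let r := z - totD k A (n + 1) u₀
    have hr : r ∈ S.tot (m + 1) := Submodule.sub_mem _ hz (totD_mem hu₀)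
    have hrd : totD k A n r = 0 := by rw [map_sub, hd, totD_totD, sub_zero]
    have hbar : bar k A m (cons k A (m + 1) 1 (z m)) = z m := by
      obtain _ | m := m
      · rw [bar_zero, face_zero_cons_one]
      · rw [bar_cons_one, eq_zero_of_mem_wt (bar_mem (mem_tot.1 hz (m + 1))) (by omega), map_zero,
          sub_zero]
    have hp2 : ¬ Even (n + 1 - ((m : ℤ) + 1)) := by simpa using hp
    have hp3 : ¬ Even (n + 1 - ((m + 1 : ℕ) : ℤ)) := by simpa using hp
    obtain ⟨u, hu, -, hu'⟩ := exists_totD_eq hr hrd (fun j hj => by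
      rcases Nat.lt_succ_iff_lt_or_eq.1 hj with hj | rfl
      · exact S.eq_zero_of_mem_tot hr (by omega)
      · simp only [r, u₀]
        rw [Pi.sub_apply, totD_apply, Pi.single_eq_same,
          Pi.single_eq_of_ne (by omega : j ≠ j + 1), map_zero, add_zero, vert, if_neg hp2,
          LinearMap.neg_apply, map_neg, neg_neg, hbar, sub_self]) fun _ => by
      -- The horizontal part of this correction changes the obstruction in degree `m + 1` by the
      -- class of `z m`, by `tmap_proj_bar`; the new obstruction is exactly `toPeriodic` of `z`.
      have h5 : totD k A (n + 1) u₀ (m + 1) = oneSubCyc k A (m + 2) v := by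
        rw [totD_apply]
        simp only [u₀]
        rw [Pi.single_eq_same, Pi.single_eq_of_ne (by omega : m + 1 + 1 ≠ m + 1), map_zero,
          zero_add, horiz, if_neg hp3]
      simp only [r]
      rw [Pi.sub_apply, h5, map_sub, map_sub, ← tmap_proj_bar]
      simp only [v]
      rw [map_neg, map_neg, hbar, sub_neg_eq_add]
      exact (add_comm _ _).trans h
    exact ⟨u + u₀, Submodule.add_mem _ hu hu₀, by rw [map_add, hu']; simp [r]⟩

theorem toPeriodic_single (y : ⨂[k]^(m + 1) M) :
    S.toPeriodic m n (Pi.single m (tmap (m + 1) S.incl y)) = y := by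
  have h : tmap (m + 1) S.proj ((Pi.single m (tmap (m + 1) S.incl y) : Tot k A) m) = y := by
    rw [Pi.single_eq_same, tmap_proj_tmap_incl]
  rw [toPeriodic]
  split_ifs
  · exact h
  · simp only [LinearMap.add_apply, LinearMap.comp_apply, LinearMap.proj_apply]
    rw [h, Pi.single_eq_of_ne (by omega : m + 1 ≠ m), map_zero, map_zero, add_zero]

theorem toPeriodic_eq_zero {z : Tot k A} (h : ∀ j ≤ m + 1, z j = 0) : S.toPeriodic m n z = 0 := by
  rw [toPeriodic]
  split_ifs <;>
    simp [h m (by omega), h (m + 1) le_rfl]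

/-- Surjectivity on homology. The class `y`, placed in degree `m`, has a differential that
`exists_totD_eq` lifts to degrees above `m + 1`, where `toPeriodic` does not see it. -/
theorem exists_cycle_toPeriodic_eq {y : ⨂[k]^(m + 1) M} (hy : periodicD k M m n y = 0) :
    ∃ z ∈ S.tot (m + 1), totD k A n z = 0 ∧ S.toPeriodic m n z = y := by
  let z₀ : Tot k A := Pi.single m (tmap (m + 1) S.incl y)
  have hz₀ : z₀ ∈ S.tot (m + 1) := single_mem_tot (tmap_incl_mem y)
  have hn : n - 1 + 1 = n := by ring
  have hr : totD k A (n - 1 + 1) z₀ ∈ S.tot (m + 1) := totD_mem hz₀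
  have hw : totD k A (n - 1 + 1) z₀ (m + 1) = 0 := by
    rw [totD_apply]
    simp only [z₀]
    rw [Pi.single_eq_of_ne (by omega : m + 1 + 1 ≠ m), Pi.single_eq_of_ne (by omega : m + 1 ≠ m),
      map_zero, map_zero, add_zero]
  obtain ⟨u, hu, hu0, hu'⟩ := exists_totD_eq hr (totD_totD _ _) (fun j hj => by
    rcases Nat.lt_succ_iff_lt_or_eq.1 hj with hj | rfl
    · exact S.eq_zero_of_mem_tot hr (by omega)
    · rw [totD_apply]
      simp only [z₀]
      rw [Pi.single_eq_same, Pi.single_eq_of_ne (by omega : j + 1 ≠ j), map_zero, zero_add, hn,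
        ← tmap_periodicD, hy, map_zero]) fun _ => by rw [hw, map_zero, map_zero]
  rw [hn] at hu'
  refine ⟨z₀ - u, Submodule.sub_mem _ hz₀ hu, ?_, ?_⟩
  · rw [map_sub, hu', sub_self]
  · rw [map_sub, toPeriodic_eq_zero hu0, sub_zero, toPeriodic_single]

variable (S m n)

/-- The homology of the weight `m + 1` part of the total complex is the homology of the
two-periodic complex of the cyclic group acting on `M^{⊗ m+1}`. -/
theorem nonempty_homology_equiv_periodic :
    Nonempty (((cycles k A n ⊓ S.tot (m + 1) : Submodule k (Tot k A)) ⧸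
      ((S.tot (m + 1)).map (totD k A (n + 1))).submoduleOf (cycles k A n ⊓ S.tot (m + 1))) ≃ₗ[k]
      (LinearMap.ker (periodicD k M m n) ⧸
        (LinearMap.range (periodicD k M m (n + 1))).submoduleOf
          (LinearMap.ker (periodicD k M m n)))) := by
  have hker : ∀ z ∈ (cycles k A n ⊓ S.tot (m + 1) : Submodule k (Tot k A)),
      S.toPeriodic m n z ∈ LinearMap.ker (periodicD k M m n) := by
    rintro z ⟨hz, -⟩
    have h := S.toPeriodic_totD m (n - 1) z
    rw [show n - 1 + 1 = n by ring, LinearMap.mem_ker.1 hz, map_zero] at h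
    exact h.symm
  let f := (Submodule.mkQ ((LinearMap.range (periodicD k M m (n + 1))).submoduleOf
    (LinearMap.ker (periodicD k M m n)))) ∘ₗ (S.toPeriodic m n).restrict hker
  have hf : Function.Surjective f := by
    intro y
    obtain ⟨⟨y, hy⟩, rfl⟩ := Submodule.mkQ_surjective _ y
    obtain ⟨z, hz, hzd, h⟩ := exists_cycle_toPeriodic_eq (S := S) hy
    refine ⟨⟨z, hzd, hz⟩, ?_⟩
    simp only [f, LinearMap.comp_apply]
    congr 1
    exact Subtype.ext h
  refine ⟨(Submodule.quotEquivOfEq _ _ ?_).trans (f.quotKerEquivOfSurjective hf)⟩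
  ext ⟨z, hzd, hz⟩
  have hfz : (⟨z, hzd, hz⟩ : (cycles k A n ⊓ S.tot (m + 1) : Submodule k (Tot k A))) ∈
      LinearMap.ker f ↔ ∃ y, periodicD k M m (n + 1) y = S.toPeriodic m n z := by
    simp only [f]
    rw [LinearMap.mem_ker, LinearMap.comp_apply, Submodule.mkQ_apply, Submodule.Quotient.mk_eq_zero]
    exact Iff.rfl
  rw [hfz, Submodule.submoduleOf, Submodule.mem_comap, Submodule.mem_map, Submodule.subtype_apply]
  constructor
  · rintro ⟨u, -, rfl⟩
    exact ⟨S.toPeriodic m (n + 1) u, (S.toPeriodic_totD m n u).symm⟩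
  · rintro ⟨y, hy⟩
    let u₀ : Tot k A := Pi.single m (tmap (m + 1) S.incl y)
    have hu₀ : u₀ ∈ S.tot (m + 1) := single_mem_tot (tmap_incl_mem y)
    -- Subtracting the boundary of `y`, placed in degree `m`, reduces to a cycle with image zero on
    -- the chain level.
    obtain ⟨u, hu, h⟩ := exists_totD_eq_of_toPeriodic_eq_zero (n := n)
      (z := z - totD k A (n + 1) u₀) (Submodule.sub_mem _ hz (totD_mem hu₀))
      (by rw [map_sub, LinearMap.mem_ker.1 hzd, totD_totD, sub_zero])
      (by rw [map_sub, toPeriodic_totD, toPeriodic_single, ← hy, sub_self])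
    exact ⟨u + u₀, Submodule.add_mem _ hu hu₀, by rw [map_add, h, sub_add_cancel]⟩

end Positive

/-! ### Weight zero. -/

section Zero

variable (S n)

theorem subsingleton_homology_zero (hn : Odd n) :
    Subsingleton ((cycles k A n ⊓ S.tot 0 : Submodule k (Tot k A)) ⧸
      ((S.tot 0).map (totD k A (n + 1))).submoduleOf (cycles k A n ⊓ S.tot 0)) := by
  rw [Submodule.Quotient.subsingleton_iff, eq_top_iff]
  rintro ⟨z, hzd, hz⟩ -
  obtain ⟨u, hu, -, h⟩ := exists_totD_eq hz hzd (fun j hj => by omega) fun hp => by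
    simp only [Nat.cast_zero, sub_zero] at hp
    exact absurd hp (Int.not_even_iff_odd.2 hn)
  exact ⟨u, hu, h⟩

theorem nonempty_homology_zero_equiv (hn : Even n) :
    Nonempty (((cycles k A n ⊓ S.tot 0 : Submodule k (Tot k A)) ⧸
      ((S.tot 0).map (totD k A (n + 1))).submoduleOf (cycles k A n ⊓ S.tot 0)) ≃ₗ[k] k) := by
  let e : (⨂[k]^0 M) ≃ₗ[k] k := PiTensorProduct.isEmptyEquiv (Fin 0)
  let g : Tot k A →ₗ[k] ⨂[k]^0 M := tmap 0 S.proj ∘ₗ S.augHead 0 ∘ₗ LinearMap.proj 0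
  let f := e.toLinearMap ∘ₗ g ∘ₗ (cycles k A n ⊓ S.tot 0 : Submodule k (Tot k A)).subtype
  have hn1 : n - 1 + 1 = n := by ring
  have hf : Function.Surjective f := by
    intro c
    let z₀ : Tot k A := Pi.single 0 (cons k A 0 1 (tmap 0 S.incl (e.symm c)))
    have hz₀ : z₀ ∈ S.tot 0 := single_mem_tot (cons_one_mem (tmap_incl_mem _))
    -- The element `c · 1` in simplicial degree `0` is not a cycle. Its differential has odd degree
    -- `n - 1`, where there is no obstruction, so a correction in positive simplicial degrees
    -- completes it.
    obtain ⟨u, hu, hu0, h⟩ := exists_totD_eq (n := n - 1) (totD_mem (n := n - 1 + 1) hz₀)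
      (totD_totD _ _) (fun j hj => by omega) fun hp => by
        simp only [Nat.cast_zero, sub_zero] at hp
        grind
    rw [hn1] at h
    refine ⟨⟨z₀ - u, ?_, Submodule.sub_mem _ hz₀ hu⟩, ?_⟩
    · change totD k A n (z₀ - u) = 0
      rw [map_sub, h, sub_self]
    · simp only [f, g, LinearMap.comp_apply, Submodule.subtype_apply, LinearMap.proj_apply,
        Pi.sub_apply, hu0 0 le_rfl, sub_zero, z₀]
      rw [Pi.single_eq_same, augHead_cons, map_one, one_smul, tmap_proj_tmap_incl]
      simp
  refine ⟨(Submodule.quotEquivOfEq _ _ ?_).trans (f.quotKerEquivOfSurjective hf)⟩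
  ext ⟨z, hzd, hz⟩
  have hfz : (⟨z, hzd, hz⟩ : (cycles k A n ⊓ S.tot 0 : Submodule k (Tot k A))) ∈ LinearMap.ker f ↔
      tmap 0 S.proj (S.augHead 0 (z 0)) = 0 := by
    simp [f, g]
  rw [hfz, Submodule.submoduleOf, Submodule.mem_comap, Submodule.mem_map, Submodule.subtype_apply]
  constructor
  · rintro ⟨u, -, rfl⟩
    have h1 : Even (n + 1 - (((0 : ℕ) : ℤ) + 1)) := by simpa using hn
    have h2 : ¬ Even (n + 1 - ((0 : ℕ) : ℤ)) := by simp; grind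
    -- The invariant vanishes on boundaries: `t` is the identity on `A^{⊗ 1}`, and the augmentation
    -- kills the contribution of `b`.
    have h3 : oneSubCyc k A 1 = 0 := by
      rw [oneSubCyc, sub_eq_zero]
      simpa using (cyc_pow_self k A 1).symm
    simp only [totD_apply, vert, horiz]
    rw [if_pos h1, if_neg h2, h3, LinearMap.zero_apply, add_zero, tmap_proj_augHead_hochschild]
  · intro h
    obtain ⟨u, hu, -, h⟩ := exists_totD_eq hz hzd (fun j hj => by omega) fun _ => h
    exact ⟨u, hu, h⟩

end Zero

end SquareZeroSplitting

/-! ### Weight projections and the product decomposition of the homology. -/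

section Quotients

variable {R V ι : Type*} [CommRing R] [AddCommGroup V] [Module R V]

/-- A subquotient is the product of the subquotients onto which a family of operators maps it. -/
theorem exists_subquotient_equiv_pi (C B : Submodule R V) (C' B' : ι → Submodule R V)
    (P : ι → V →ₗ[R] V) (hC : ∀ i, ∀ z ∈ C, P i z ∈ C' i)
    (hsurj : ∀ c : ∀ i, C' i, ∃ z ∈ C, ∀ i, P i z = c i)
    (hB : ∀ z ∈ C, z ∈ B ↔ ∀ i, P i z ∈ B' i) :
    ∃ Φ : (C ⧸ B.submoduleOf C) ≃ₗ[R] ∀ i, C' i ⧸ (B' i).submoduleOf (C' i),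
      ∀ (z : C) (c : ∀ i, C' i), (∀ i, P i z = c i) →
        Φ (Submodule.Quotient.mk z) = fun i => Submodule.Quotient.mk (c i) := by
  let f : C →ₗ[R] ∀ i, C' i ⧸ (B' i).submoduleOf (C' i) :=
    LinearMap.pi fun i => Submodule.mkQ _ ∘ₗ (P i).restrict (hC i)
  have hfc : ∀ (z : C) (c : ∀ i, C' i), (∀ i, P i z = c i) →
      f z = fun i => Submodule.Quotient.mk (c i) := by
    intro z c h
    funext i
    exact congrArg Submodule.Quotient.mk (Subtype.ext (h i))
  have hf : Function.Surjective f := by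
    intro y
    choose c hc using fun i => Submodule.Quotient.mk_surjective _ (y i)
    obtain ⟨z, hz, h⟩ := hsurj c
    exact ⟨⟨z, hz⟩, (hfc _ c h).trans (funext hc)⟩
  have hker : B.submoduleOf C = LinearMap.ker f := by
    ext ⟨z, hz⟩
    rw [LinearMap.mem_ker, funext_iff, Submodule.submoduleOf, Submodule.mem_comap]
    refine (hB z hz).trans (forall_congr' fun i => ?_)
    exact (Submodule.Quotient.mk_eq_zero ((B' i).submoduleOf (C' i))
      (x := (P i).restrict (hC i) ⟨z, hz⟩)).symm
  exact ⟨(Submodule.quotEquivOfEq _ _ hker).trans (f.quotKerEquivOfSurjective hf), hfc⟩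

end Quotients

namespace SquareZeroSplitting

variable {k : Type u} [CommRing k] {A M : Type u} [Ring A] [Algebra k A] [AddCommGroup M]
  [Module k M] (S : SquareZeroSplitting k A M)

/-- The projection of `A^{⊗ r}` onto its part of weight `w`. -/
def wtProj : ∀ r _w : ℕ, Module.End k (⨂[k]^r A)
  | 0, 0 => 1
  | 0, _ + 1 => 0
  | r + 1, 0 => cons k A r 1 ∘ₗ wtProj r 0 ∘ₗ S.augHead r
  | r + 1, w + 1 => cons k A r 1 ∘ₗ wtProj r (w + 1) ∘ₗ S.augHead r +
      consLift (LinearMap.lcomp k _ (wtProj r w) ∘ₗ cons k A r ∘ₗ S.incl ∘ₗ S.proj)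

theorem wtProj_cons_one (r w : ℕ) (x : ⨂[k]^r A) :
    S.wtProj (r + 1) w (cons k A r 1 x) = cons k A r 1 (S.wtProj r w x) := by
  cases w <;> simp [wtProj, consLift_cons, augHead_cons, S.proj_one]

theorem wtProj_cons_incl_zero (r : ℕ) (y : M) (x : ⨂[k]^r A) :
    S.wtProj (r + 1) 0 (cons k A r (S.incl y) x) = 0 := by
  simp [wtProj, augHead_cons, S.aug_incl]

theorem wtProj_cons_incl_succ (r w : ℕ) (y : M) (x : ⨂[k]^r A) :
    S.wtProj (r + 1) (w + 1) (cons k A r (S.incl y) x) =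
      cons k A r (S.incl y) (S.wtProj r w x) := by
  simp [wtProj, consLift_cons, augHead_cons, S.aug_incl, S.proj_incl]

theorem wtProj_of_mem {r v : ℕ} (w : ℕ) {x : ⨂[k]^r A} (hx : x ∈ S.wt r v) :
    S.wtProj r w x = if v = w then x else 0 := by
  induction r generalizing v w with
  | zero =>
    obtain _ | v := v
    · cases w <;> simp [wtProj]
    · rw [eq_zero_of_mem_wt hx (Nat.succ_pos v), map_zero, ite_self]
  | succ r ih =>
    let f : Module.End k (⨂[k]^(r + 1) A) := if v = w then LinearMap.id else 0
    have hf : ∀ x, f x = if v = w then x else 0 := by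
      intro x
      simp only [f]
      split_ifs <;> rfl
    have : S.wt (r + 1) v ≤ LinearMap.eqLocus (S.wtProj (r + 1) w) f := by
      apply wt_succ_le
      · intro x hx
        rw [LinearMap.mem_eqLocus, hf, wtProj_cons_one, ih w hx]
        split_ifs <;> simp
      · rintro v' y rfl x hx
        rw [LinearMap.mem_eqLocus, hf]
        obtain _ | w := w
        · rw [wtProj_cons_incl_zero, if_neg (Nat.succ_ne_zero v')]
        · rw [wtProj_cons_incl_succ, ih w hx]
          by_cases h : v' = w <;> simp [h]
    rw [← hf]
    exact this hx

theorem iSup_wt_eq_top (r : ℕ) : ⨆ w, S.wt r w = ⊤ := by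
  induction r with
  | zero =>
    rw [eq_top_iff, ← PiTensorProduct.span_tprod_eq_top, Submodule.span_le]
    rintro _ ⟨x, rfl⟩
    refine Submodule.mem_iSup_of_mem 0 (Submodule.subset_span ⟨fun _ => none, ?_, ?_⟩)
    · simp [wordWeight]
    · congr 1
      exact Subsingleton.elim _ _
  | succ r ih =>
    have h : (⨆ w, S.wt (r + 1) w).mkQ = 0 := by
      apply S.split_hom_ext
      · intro x
        rw [LinearMap.zero_apply, Submodule.mkQ_apply, Submodule.Quotient.mk_eq_zero]
        have : (⊤ : Submodule k (⨂[k]^r A)) ≤ (⨆ w, S.wt (r + 1) w).comap (cons k A r 1) := by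
          rw [← ih, iSup_le_iff]
          exact fun w x hx => Submodule.mem_iSup_of_mem w (cons_one_mem hx)
        exact this trivial
      · intro y x
        rw [LinearMap.zero_apply, Submodule.mkQ_apply, Submodule.Quotient.mk_eq_zero]
        have : (⊤ : Submodule k (⨂[k]^r A)) ≤
            (⨆ w, S.wt (r + 1) w).comap (cons k A r (S.incl y)) := by
          rw [← ih, iSup_le_iff]
          exact fun w x hx => Submodule.mem_iSup_of_mem (w + 1) (cons_incl_mem hx y)
        exact this trivial
    rw [← Submodule.ker_mkQ (⨆ w, S.wt (r + 1) w), h, LinearMap.ker_zero]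

variable {S} in
theorem wt_induction {r : ℕ} {N : Submodule k (⨂[k]^r A)} (h : ∀ w, S.wt r w ≤ N)
    (x : ⨂[k]^r A) : x ∈ N := by
  have : (⊤ : Submodule k (⨂[k]^r A)) ≤ N := by
    rw [← S.iSup_wt_eq_top, iSup_le_iff]
    exact h
  exact this trivial

theorem wtProj_mem (r w : ℕ) (x : ⨂[k]^r A) : S.wtProj r w x ∈ S.wt r w := by
  apply wt_induction (S := S) (N := (S.wt r w).comap (S.wtProj r w))
  intro v x hx
  rw [Submodule.mem_comap, S.wtProj_of_mem w hx]
  split_ifs with h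
  · rwa [← h]
  · exact Submodule.zero_mem _

theorem sum_wtProj (r : ℕ) (x : ⨂[k]^r A) :
    ∑ w ∈ Finset.range (r + 1), S.wtProj r w x = x := by
  have := wt_induction (S := S)
    (N := LinearMap.eqLocus (∑ w ∈ Finset.range (r + 1), S.wtProj r w) LinearMap.id)
    (fun v x hx => by
      rw [LinearMap.mem_eqLocus, LinearMap.sum_apply, LinearMap.id_apply]
      simp only [S.wtProj_of_mem _ hx]
      by_cases h : v < r + 1
      · simp [h]
      · rw [eq_zero_of_mem_wt hx (by omega)]
        simp) x
  rwa [LinearMap.mem_eqLocus, LinearMap.sum_apply] at this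

theorem wtProj_comm {r s : ℕ} {f : (⨂[k]^r A) →ₗ[k] ⨂[k]^s A}
    (hf : ∀ w, ∀ x ∈ S.wt r w, f x ∈ S.wt s w) (w : ℕ) (x : ⨂[k]^r A) :
    S.wtProj s w (f x) = f (S.wtProj r w x) := by
  refine wt_induction (S := S) (N := LinearMap.eqLocus (S.wtProj s w ∘ₗ f) (f ∘ₗ S.wtProj r w))
    (fun v x hx => ?_) x
  rw [LinearMap.mem_eqLocus, LinearMap.comp_apply, LinearMap.comp_apply,
    S.wtProj_of_mem w hx, S.wtProj_of_mem w (hf v x hx)]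
  split_ifs <;> simp

theorem isInternal_wt (r : ℕ) : DirectSum.IsInternal fun w : ℕ => S.wt r w := by
  refine DirectSum.isInternal_submodule_of_iSupIndep_of_iSup_eq_top ?_ (S.iSup_wt_eq_top r)
  intro w
  rw [Submodule.disjoint_def]
  intro x hx hx'
  have h : ⨆ v, ⨆ (_ : v ≠ w), S.wt r v ≤ LinearMap.ker (S.wtProj r w) := by
    refine iSup₂_le fun v hv x hx => ?_
    rw [LinearMap.mem_ker, S.wtProj_of_mem w hx, if_neg hv]
  have h' := h hx'
  rwa [LinearMap.mem_ker, S.wtProj_of_mem w hx, if_pos rfl] at h'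

/-- The projection of the total complex onto its part of weight `w`. -/
def totProj (w : ℕ) : Tot k A →ₗ[k] Tot k A :=
  LinearMap.pi fun q => S.wtProj (q + 1) w ∘ₗ LinearMap.proj q

theorem totProj_apply (w : ℕ) (z : Tot k A) (q : ℕ) :
    S.totProj w z q = S.wtProj (q + 1) w (z q) := rfl

theorem totProj_mem (w : ℕ) (z : Tot k A) : S.totProj w z ∈ S.tot w :=
  mem_tot.2 fun q => S.wtProj_mem (q + 1) w (z q)

theorem totProj_of_mem {v : ℕ} (w : ℕ) {z : Tot k A} (hz : z ∈ S.tot v) :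
    S.totProj w z = if v = w then z else 0 := by
  ext q
  rw [totProj_apply, S.wtProj_of_mem w (mem_tot.1 hz q)]
  split_ifs <;> rfl

theorem totD_totProj (n : ℤ) (w : ℕ) (z : Tot k A) :
    totD k A n (S.totProj w z) = S.totProj w (totD k A n z) := by
  ext q
  rw [totD_apply, totProj_apply, totProj_apply, totProj_apply, totD_apply, map_add,
    S.wtProj_comm (fun _ _ h => vert_mem h), S.wtProj_comm (fun _ _ h => horiz_mem h)]

theorem eq_of_totProj_eq {z z' : Tot k A} (h : ∀ w, S.totProj w z = S.totProj w z') : z = z' := by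
  ext q
  rw [← S.sum_wtProj (q + 1) (z q), ← S.sum_wtProj (q + 1) (z' q)]
  exact Finset.sum_congr rfl fun w _ => congrFun (h w) q

/-- The element of the total complex with prescribed components in the various weights. -/
def assemble (c : ℕ → Tot k A) : Tot k A := fun q => ∑ w ∈ Finset.range (q + 2), c w q

/-- The range `q + 2` contains all weights `0, …, q + 1` of `A^{⊗ q+1}`; components of larger weight
have zero entry there. -/
theorem totProj_of_eq_sum {c : ℕ → Tot k A} (hc : ∀ w, c w ∈ S.tot w) {z : Tot k A}
    (hz : ∀ q, z q = ∑ w ∈ Finset.range (q + 2), c w q) (w : ℕ) : S.totProj w z = c w := by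
  ext q
  rw [totProj_apply, hz, map_sum]
  have h : ∀ v, S.wtProj (q + 1) w (c v q) = if v = w then c v q else 0 := fun v =>
    S.wtProj_of_mem w (mem_tot.1 (hc v) q)
  simp only [h]
  by_cases hw : w < q + 2
  · simp [hw]
  · rw [eq_zero_of_mem_wt (mem_tot.1 (hc w) q) (by omega)]
    simp [hw]

/-- The homology of the total complex is the product of the homologies of its weight parts. -/
theorem exists_homology_equiv (n : ℤ) :
    ∃ Φ : HP k A n ≃ₗ[k] ∀ w : ℕ, (cycles k A n ⊓ S.tot w : Submodule k (Tot k A)) ⧸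
      ((S.tot w).map (totD k A (n + 1))).submoduleOf (cycles k A n ⊓ S.tot w),
      ∀ (z : cycles k A n) (c : ∀ w : ℕ, (cycles k A n ⊓ S.tot w : Submodule k (Tot k A))),
        (∀ w, S.totProj w z = c w) →
        Φ (Submodule.Quotient.mk z) = fun w => Submodule.Quotient.mk (c w) := by
  refine exists_subquotient_equiv_pi _ _ _ _ S.totProj (fun w z hz => ⟨?_, S.totProj_mem w z⟩)
    (fun c => ?_) (fun z _ => ⟨?_, fun h => ?_⟩)
  · change totD k A n (S.totProj w z) = 0
    rw [totD_totProj, LinearMap.mem_ker.1 hz, map_zero]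
  · have h := S.totProj_of_eq_sum (c := fun w => (c w : Tot k A)) (fun w => (c w).2.2)
      (z := assemble fun w => (c w : Tot k A)) fun _ => rfl
    refine ⟨assemble fun w => (c w : Tot k A), ?_, h⟩
    rw [LinearMap.mem_ker]
    apply S.eq_of_totProj_eq
    intro w
    rw [← totD_totProj, h, map_zero]
    exact (c w).2.1
  · rintro ⟨u, rfl⟩ w
    exact ⟨S.totProj w u, S.totProj_mem w u, S.totD_totProj _ w u⟩
  -- Primitives chosen independently in all weights assemble into one element of the product total
  -- complex.
  · choose u hu hu' using h
    refine ⟨assemble u, S.eq_of_totProj_eq fun w => ?_⟩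
    rw [← totD_totProj, S.totProj_of_eq_sum hu (z := assemble u) (fun _ => rfl), hu']

end SquareZeroSplitting

/-! ### Tate cohomology of finite cyclic groups. -/

section Subquotients

variable {R V W : Type*} [CommRing R] [AddCommGroup V] [Module R V] [AddCommGroup W] [Module R W]

/-- The homology of `V --f--> V --g--> V`. -/
abbrev EndHomology (f g : Module.End R V) : Type _ :=
  LinearMap.ker g ⧸ (LinearMap.range f).submoduleOf (LinearMap.ker g)

theorem nonempty_subquotient_equiv (e : V ≃ₗ[R] W) (C B : Submodule R V) (C' B' : Submodule R W)
    (hC : ∀ x, x ∈ C ↔ e x ∈ C') (hB : ∀ x, x ∈ B ↔ e x ∈ B') :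
    Nonempty ((C ⧸ B.submoduleOf C) ≃ₗ[R] (C' ⧸ B'.submoduleOf C')) := by
  let f : C →ₗ[R] C' ⧸ B'.submoduleOf C' :=
    Submodule.mkQ _ ∘ₗ e.toLinearMap.restrict fun x hx => (hC x).1 hx
  have hf : Function.Surjective f := by
    intro y
    obtain ⟨⟨y, hy⟩, rfl⟩ := Submodule.Quotient.mk_surjective _ y
    refine ⟨⟨e.symm y, (hC _).2 (by simpa using hy)⟩, ?_⟩
    exact congrArg Submodule.Quotient.mk (Subtype.ext (e.apply_symm_apply y))
  refine ⟨(Submodule.quotEquivOfEq _ _ ?_).trans (f.quotKerEquivOfSurjective hf)⟩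
  ext ⟨x, hx⟩
  rw [LinearMap.mem_ker]
  exact (hB x).trans (Submodule.Quotient.mk_eq_zero (B'.submoduleOf C')
    (x := e.toLinearMap.restrict (fun x hx => (hC x).1 hx) ⟨x, hx⟩)).symm

end Subquotients

section Tate

open CategoryTheory

variable {k G : Type u} [CommRing k]

theorem nonempty_shortComplex_homology_equiv {W : Type u} [AddCommGroup W] [Module k W]
    (S : ShortComplex (ModuleCat.{u} k)) (e : S.X₂ ≃ₗ[k] W) (C B : Submodule k W)
    (hC : ∀ x, S.g.hom x = 0 ↔ e x ∈ C) (hB : ∀ x, x ∈ LinearMap.range S.f.hom ↔ e x ∈ B) :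
    Nonempty (S.homology ≃ₗ[k] (C ⧸ B.submoduleOf C)) := by
  obtain ⟨e'⟩ := nonempty_subquotient_equiv e (LinearMap.ker S.g.hom) (LinearMap.range S.f.hom)
    C B hC hB
  refine ⟨(S.moduleCatHomologyIso.toLinearEquiv.trans (Submodule.quotEquivOfEq _ _ ?_)).trans e'⟩
  ext ⟨x, hx⟩
  constructor
  · rintro ⟨y, hy⟩
    exact ⟨y, congrArg Subtype.val hy⟩
  · rintro ⟨y, hy⟩
    exact ⟨y, Subtype.ext hy⟩

variable [CommGroup G] (X : Rep.{u} k G) (g : G)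

theorem applyAsHom_sub_id_toLinearMap :
    (Rep.applyAsHom X g - 𝟙 X).hom.toLinearMap = X.ρ g - 1 := by
  ext x
  simp [Rep.sub_hom, Rep.applyAsHom]

variable {g} in
theorem inhomogeneousCochains_d_zero_one_eq_zero_iff (hg : ∀ x, x ∈ Subgroup.zpowers g)
    (x : (groupCohomology.inhomogeneousCochains X).X 0) :
    ((groupCohomology.inhomogeneousCochains X).d 0 1).hom x = 0 ↔
      X.ρ g ((groupCohomology.cochainsIso₀ X).hom.hom x) =
        (groupCohomology.cochainsIso₀ X).hom.hom x := by
  rw [← Representation.mem_invariants_iff_of_forall_mem_zpowers X.ρ g hg,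
    ← groupCohomology.d₀₁_ker_eq_invariants, LinearMap.mem_ker]
  have h := congrArg (fun f => f.hom x) (groupCohomology.comp_d₀₁_eq X)
  simp only [ModuleCat.hom_comp, LinearMap.comp_apply] at h
  rw [h]
  exact (map_eq_zero_iff _ (groupCohomology.cochainsIso₁ X).toLinearEquiv.injective).symm

variable {g} in
theorem mem_range_inhomogeneousChains_d_one_zero_iff [Finite G] (hg : ∀ x, x ∈ Subgroup.zpowers g)
    (y : (groupHomology.inhomogeneousChains X).X 0) :
    y ∈ LinearMap.range ((groupHomology.inhomogeneousChains X).d 1 0).hom ↔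
      (groupHomology.chainsIso₀ X).hom.hom y ∈ LinearMap.range (X.ρ g - 1) := by
  change _ ↔ _ ∈ LinearMap.range (X.ρ g - LinearMap.id)
  rw [← Representation.FiniteCyclicGroup.coinvariantsKer_eq_range X.ρ g hg,
    ← groupHomology.range_d₁₀_eq_coinvariantsKer]
  have h := fun x => congrArg (fun f => f.hom x) (groupHomology.comp_d₁₀_eq X)
  simp only [ModuleCat.hom_comp, LinearMap.comp_apply] at h
  constructor
  · rintro ⟨x, rfl⟩
    exact ⟨_, h x⟩
  · rintro ⟨x, hx⟩
    obtain ⟨x, rfl⟩ := (groupHomology.chainsIso₁ X).toLinearEquiv.surjective x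
    refine ⟨x, (groupHomology.chainsIso₀ X).toLinearEquiv.injective ?_⟩
    exact (h x).symm.trans hx

variable [Fintype G]

/-- The homology of `X --N--> X --(ρ(g) - 1)--> X`. -/
abbrev EvenTate : Type u := EndHomology X.ρ.norm (X.ρ g - 1)

/-- The homology of `X --(ρ(g) - 1)--> X --N--> X`. -/
abbrev OddTate : Type u := EndHomology (X.ρ g - 1) X.ρ.norm

theorem norm_hom_toLinearMap : X.norm.hom.toLinearMap = X.ρ.norm := by
  ext x
  simp [Rep.norm]

theorem nonempty_normHomCompSub_equiv :
    Nonempty ((Rep.FiniteCyclicGroup.normHomCompSub X g).homology ≃ₗ[k] EvenTate X g) :=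
  nonempty_shortComplex_homology_equiv (Rep.FiniteCyclicGroup.normHomCompSub X g)
    (LinearEquiv.refl k X) _ _
    (fun _ => by rw [← applyAsHom_sub_id_toLinearMap]; exact Iff.rfl)
    (fun _ => by rw [← norm_hom_toLinearMap]; exact Iff.rfl)

theorem nonempty_subCompNormHom_equiv :
    Nonempty ((Rep.FiniteCyclicGroup.subCompNormHom X g).homology ≃ₗ[k] OddTate X g) :=
  nonempty_shortComplex_homology_equiv (Rep.FiniteCyclicGroup.subCompNormHom X g)
    (LinearEquiv.refl k X) _ _
    (fun _ => by rw [← norm_hom_toLinearMap]; exact Iff.rfl)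
    (fun _ => by rw [← applyAsHom_sub_id_toLinearMap]; exact Iff.rfl)

variable {g}

theorem mem_range_tateNorm_iff (y : (groupCohomology.inhomogeneousCochains X).X 0) :
    y ∈ LinearMap.range X.tateNorm.hom ↔
      (groupCohomology.cochainsIso₀ X).hom.hom y ∈ LinearMap.range X.ρ.norm := by
  have h : ∀ x, (groupCohomology.cochainsIso₀ X).hom.hom (X.tateNorm.hom x) =
      X.ρ.norm ((groupHomology.chainsIso₀ X).hom.hom x) := fun x =>
    (groupCohomology.cochainsIso₀ X).toLinearEquiv.apply_symm_apply _
  constructor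
  · rintro ⟨x, rfl⟩
    exact ⟨_, (h x).symm⟩
  · rintro ⟨x, hx⟩
    obtain ⟨x, rfl⟩ := (groupHomology.chainsIso₀ X).toLinearEquiv.surjective x
    exact ⟨x, (groupCohomology.cochainsIso₀ X).toLinearEquiv.injective ((h x).trans hx)⟩

theorem tateNorm_eq_zero_iff (x : (groupHomology.inhomogeneousChains X).X 0) :
    X.tateNorm.hom x = 0 ↔ X.ρ.norm ((groupHomology.chainsIso₀ X).hom.hom x) = 0 :=
  map_eq_zero_iff _ (groupCohomology.cochainsIso₀ X).toLinearEquiv.symm.injective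

/-- Degrees `0` and `-1` are where the norm splices chains to cochains. They are computed directly:
a generator detects invariants, and the image of `ρ(g) - 1` is the kernel of the map to
coinvariants. -/
theorem nonempty_tateCohomology_zero_equiv (hg : ∀ x, x ∈ Subgroup.zpowers g) :
    Nonempty (tateCohomology X 0 ≃ₗ[k] EvenTate X g) := by
  obtain ⟨e⟩ := nonempty_shortComplex_homology_equiv ((tateComplex X).sc' (-1) 0 1)
    (groupCohomology.cochainsIso₀ X).toLinearEquiv (LinearMap.ker (X.ρ g - 1))
    (LinearMap.range X.ρ.norm)
    (fun x => by
      rw [LinearMap.mem_ker, LinearMap.sub_apply, sub_eq_zero]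
      exact inhomogeneousCochains_d_zero_one_eq_zero_iff X hg x)
    (mem_range_tateNorm_iff X)
  exact ⟨(((tateComplex X).homologyIsoSc' (-1) 0 1 (by simp) (by simp)).toLinearEquiv).trans e⟩

theorem nonempty_tateCohomology_neg_one_equiv (hg : ∀ x, x ∈ Subgroup.zpowers g) :
    Nonempty (tateCohomology X (-1) ≃ₗ[k] OddTate X g) := by
  obtain ⟨e⟩ := nonempty_shortComplex_homology_equiv (ShortComplex.mk _ _ (Rep.d_comp_tateNorm X))
    (groupHomology.chainsIso₀ X).toLinearEquiv (LinearMap.ker X.ρ.norm)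
    (LinearMap.range (X.ρ g - 1)) (tateNorm_eq_zero_iff X)
    (mem_range_inhomogeneousChains_d_one_zero_iff X hg)
  exact ⟨(((tateComplex X).homologyIsoSc' (-2) (-1) 0 (by simp) (by simp)).toLinearEquiv).trans e⟩

theorem nonempty_tateCohomology_even_equiv (hg : ∀ x, x ∈ Subgroup.zpowers g)
    {i : ℤ} (hi : Even i) :
    Nonempty (tateCohomology X i ≃ₗ[k] EvenTate X g) := by
  classical
  obtain ⟨e⟩ := nonempty_normHomCompSub_equiv X g
  rcases lt_trichotomy i 0 with h | rfl | h
  -- Tate degree `-(j + 1)` is group homology in degree `j`, so the parity flips.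
  · obtain ⟨j, rfl⟩ : ∃ j : ℕ, i = -(j + 1) := ⟨(-i - 1).toNat, by omega⟩
    have hj : Odd j := by
      rw [← Int.odd_coe_nat]
      grind
    have : NeZero j := ⟨hj.pos.ne'⟩
    exact ⟨(((TateCohomology.isoGroupHomology _ j rfl).app X).toLinearEquiv.trans
      (Rep.FiniteCyclicGroup.groupHomologyIsoOdd X g hg j hj).toLinearEquiv).trans e⟩
  · exact nonempty_tateCohomology_zero_equiv X hg
  · obtain ⟨j, rfl⟩ : ∃ j : ℕ, i = j := ⟨i.toNat, by omega⟩
    have hj : Even j := by exact_mod_cast hi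
    have : NeZero j := ⟨by omega⟩
    exact ⟨(((TateCohomology.isoGroupCohomology j).app X).toLinearEquiv.trans
      (Rep.FiniteCyclicGroup.groupCohomologyIsoEven X g hg j hj).toLinearEquiv).trans e⟩

theorem nonempty_tateCohomology_odd_equiv (hg : ∀ x, x ∈ Subgroup.zpowers g) {i : ℤ} (hi : Odd i) :
    Nonempty (tateCohomology X i ≃ₗ[k] OddTate X g) := by
  classical
  obtain ⟨e⟩ := nonempty_subCompNormHom_equiv X g
  rcases lt_or_ge i 0 with h | h
  · obtain ⟨j, rfl⟩ : ∃ j : ℕ, i = -(j + 1) := ⟨(-i - 1).toNat, by omega⟩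
    have hj : Even j := by
      rw [← Int.even_coe_nat]
      grind
    rcases Nat.eq_zero_or_pos j with rfl | hj0
    · exact nonempty_tateCohomology_neg_one_equiv X hg
    have : NeZero j := ⟨hj0.ne'⟩
    exact ⟨(((TateCohomology.isoGroupHomology _ j rfl).app X).toLinearEquiv.trans
      (Rep.FiniteCyclicGroup.groupHomologyIsoEven X g hg j hj).toLinearEquiv).trans e⟩
  · obtain ⟨j, rfl⟩ : ∃ j : ℕ, i = j := ⟨i.toNat, by omega⟩
    have hj : Odd j := by exact_mod_cast hi
    have : NeZero j := ⟨hj.pos.ne'⟩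
    exact ⟨(((TateCohomology.isoGroupCohomology j).app X).toLinearEquiv.trans
      (Rep.FiniteCyclicGroup.groupCohomologyIsoOdd X g hg j hj).toLinearEquiv).trans e⟩

end Tate

/-! ### The algebra `k[x₁, …, x_d] / 𝔪²` as a square-zero extension. -/

section Splitting

variable (k : Type u) [CommRing k] (d : ℕ)

theorem X_mem_maxIdeal (j : Fin d) : (MvPolynomial.X j : MvPolynomial (Fin d) k) ∈ maxIdeal k d :=
  Ideal.subset_span ⟨j, rfl⟩

/-- The algebra `k[x₁, …, x_d] / 𝔪²` maps to the trivial square-zero extension of `k` by `k^d`. -/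
def toTrivSqZero : TruncAlg k d →ₐ[k] TrivSqZeroExt k (Fin d → k) :=
  Ideal.Quotient.liftₐ (maxIdeal k d ^ 2)
    (MvPolynomial.aeval fun j => TrivSqZeroExt.inr (Pi.single j 1)) (by
      have h : maxIdeal k d ≤ Ideal.comap (MvPolynomial.aeval (R := k)
          fun j => (TrivSqZeroExt.inr (Pi.single j 1) : TrivSqZeroExt k (Fin d → k)))
            (RingHom.ker (TrivSqZeroExt.fstHom k k (Fin d → k))) := by
        rw [maxIdeal, Ideal.span_le]
        rintro _ ⟨j, rfl⟩
        simp [RingHom.mem_ker]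
      intro p hp
      have h2 : maxIdeal k d ^ 2 ≤ RingHom.ker (MvPolynomial.aeval (R := k)
          fun j => (TrivSqZeroExt.inr (Pi.single j 1) : TrivSqZeroExt k (Fin d → k))) := by
        rw [pow_two, Ideal.mul_le]
        intro a ha b hb
        have ha' := h ha
        have hb' := h hb
        simp only [Ideal.mem_comap, RingHom.mem_ker, TrivSqZeroExt.fstHom_apply] at ha' hb'
        rw [RingHom.mem_ker, map_mul]
        ext <;> simp [ha', hb']
      exact h2 hp)

/-- The augmentation `k[x₁, …, x_d] / 𝔪² ⟶ k`. -/
def aug : TruncAlg k d →ₐ[k] k :=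
  (TrivSqZeroExt.fstHom k k (Fin d → k)).comp (toTrivSqZero k d)

/-- The class of `x_j` in `𝔪 / 𝔪²`. -/
def gen (j : Fin d) : mBar k d :=
  (maxIdeal k d).toCotangent ⟨MvPolynomial.X j, X_mem_maxIdeal k d j⟩

/-- The inclusion of `𝔪 / 𝔪²` into `k[x₁, …, x_d] / 𝔪²`. -/
def incl : mBar k d →ₗ[k] TruncAlg k d :=
  (maxIdeal k d).cotangentToQuotientSquare.restrictScalars k

/-- The projection of `k[x₁, …, x_d] / 𝔪²` onto `𝔪 / 𝔪²`, with kernel `k`. -/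
def proj : TruncAlg k d →ₗ[k] mBar k d :=
  ∑ j : Fin d, ((LinearMap.proj j ∘ₗ TrivSqZeroExt.sndHom k (Fin d → k)) ∘ₗ
    (toTrivSqZero k d).toLinearMap).smulRight (gen k d j)

variable {k d}

theorem toTrivSqZero_mono_some (j : Fin d) :
    toTrivSqZero k d (mono k d (some j)) = TrivSqZeroExt.inr (Pi.single j 1) := by
  change MvPolynomial.aeval _ (MvPolynomial.X j) = _
  simp

theorem incl_gen (j : Fin d) : incl k d (gen k d j) = mono k d (some j) := rfl

theorem mono_none : mono k d none = 1 := rfl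

theorem aug_mono_some (j : Fin d) : aug k d (mono k d (some j)) = 0 := by
  simp [aug, toTrivSqZero_mono_some]

theorem proj_one : proj k d 1 = 0 := by
  simp [proj]

theorem proj_mono_some (j : Fin d) : proj k d (mono k d (some j)) = gen k d j := by
  simp [proj, toTrivSqZero_mono_some, Pi.single_apply]

theorem incl_mul_incl (y z : mBar k d) : incl k d y * incl k d z = 0 := by
  obtain ⟨y, rfl⟩ := (maxIdeal k d).toCotangent_surjective y
  obtain ⟨z, rfl⟩ := (maxIdeal k d).toCotangent_surjective z
  change Ideal.Quotient.mk _ (y : MvPolynomial (Fin d) k) *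
    Ideal.Quotient.mk _ (z : MvPolynomial (Fin d) k) = 0
  rw [← map_mul, Ideal.Quotient.eq_zero_iff_mem, pow_two]
  exact Ideal.mul_mem_mul y.2 z.2

/-- Induction on polynomials: the span is stable under multiplication by each `x_j`, since `x_i x_j
= 0` in the quotient. -/
theorem span_mono : Submodule.span k (Set.range (mono k d)) = ⊤ := by
  rw [eq_top_iff]
  rintro a -
  obtain ⟨p, hp⟩ := Ideal.Quotient.mk_surjective a
  rw [← hp]
  clear hp
  induction p using MvPolynomial.induction_on with
  | C c =>
    have : (Ideal.Quotient.mk (maxIdeal k d ^ 2)) (MvPolynomial.C c) = c • mono k d none := by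
      rw [mono_none, ← Algebra.algebraMap_eq_smul_one]
      rfl
    rw [this]
    exact Submodule.smul_mem _ _ (Submodule.subset_span ⟨_, rfl⟩)
  | add p q hp hq => rw [map_add]; exact Submodule.add_mem _ hp hq
  | mul_X p j hp =>
    rw [map_mul]
    change _ * mono k d (some j) ∈ _
    generalize (Ideal.Quotient.mk (maxIdeal k d ^ 2)) p = a at hp
    induction hp using Submodule.span_induction with
    | mem x hx =>
      obtain ⟨i, rfl⟩ := hx
      cases i with
      | none =>
        rw [mono_none, one_mul]
        exact Submodule.subset_span ⟨_, rfl⟩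
      | some i =>
        rw [← incl_gen, ← incl_gen, incl_mul_incl]
        exact Submodule.zero_mem _
    | zero => rw [zero_mul]; exact Submodule.zero_mem _
    | add x y _ _ hx hy => rw [add_mul]; exact Submodule.add_mem _ hx hy
    | smul c x _ hx => rw [smul_mul_assoc]; exact Submodule.smul_mem _ _ hx

/-- The augmentation and the coordinates in the trivial extension of `k` by `k^d` send the monomials
to the standard basis. -/
theorem linearIndependent_mono : LinearIndependent k (mono k d) := by
  let f : TruncAlg k d →ₗ[k] (Option (Fin d) → k) := LinearMap.pi fun i =>
    match i with
    | none => (aug k d).toLinearMap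
    | some j => (LinearMap.proj j ∘ₗ TrivSqZeroExt.sndHom k (Fin d → k)) ∘ₗ
        (toTrivSqZero k d).toLinearMap
  apply LinearIndependent.of_comp f
  have : f ∘ mono k d = Pi.basisFun k (Option (Fin d)) := by
    ext i j
    cases i <;> cases j <;>
      simp [f, aug_mono_some, toTrivSqZero_mono_some, mono_none, Pi.single_apply]
  rw [this]
  exact (Pi.basisFun k _).linearIndependent

variable (k d) in
/-- The basis `1, x₁, …, x_d` of `k[x₁, …, x_d] / 𝔪²`. -/
def monoBasis : Module.Basis (Option (Fin d)) k (TruncAlg k d) :=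
  Module.Basis.mk linearIndependent_mono span_mono.ge

theorem monoBasis_apply (i : Option (Fin d)) : monoBasis k d i = mono k d i := by
  simp [monoBasis]

theorem eq_aug_add_incl (a : TruncAlg k d) : a = aug k d a • 1 + incl k d (proj k d a) := by
  have : LinearMap.id =
      (aug k d).toLinearMap.smulRight (1 : TruncAlg k d) + incl k d ∘ₗ proj k d := by
    apply (monoBasis k d).ext
    intro i
    rw [monoBasis_apply]
    cases i with
    | none => simp [mono_none, proj_one]
    | some j => simp [aug_mono_some, proj_mono_some, incl_gen]
  exact LinearMap.congr_fun this a

theorem aug_incl (y : mBar k d) : aug k d (incl k d y) = 0 := by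
  have h : ∀ p ∈ maxIdeal k d, aug k d (Ideal.Quotient.mk _ p) = 0 := by
    intro p hp
    have : maxIdeal k d ≤ RingHom.ker ((aug k d).toRingHom.comp (Ideal.Quotient.mk _)) := by
      refine Ideal.span_le.2 ?_
      rintro _ ⟨j, rfl⟩
      exact aug_mono_some j
    exact this hp
  obtain ⟨y, rfl⟩ := (maxIdeal k d).toCotangent_surjective y
  exact h y y.2

theorem proj_incl (y : mBar k d) : proj k d (incl k d y) = y := by
  apply (maxIdeal k d).cotangentToQuotientSquare_injective
  have h := eq_aug_add_incl (incl k d y)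
  rw [aug_incl, zero_smul, zero_add] at h
  exact h.symm

theorem span_gen : Submodule.span k (Set.range (gen k d)) = ⊤ := by
  rw [eq_top_iff]
  rintro y -
  rw [← proj_incl y]
  have h : incl k d y ∈ Submodule.span k (Set.range (mono k d)) := by rw [span_mono]; trivial
  generalize incl k d y = a at h
  induction h using Submodule.span_induction with
  | mem x hx =>
    obtain ⟨i, rfl⟩ := hx
    cases i with
    | none => rw [mono_none, proj_one]; exact Submodule.zero_mem _
    | some j => rw [proj_mono_some]; exact Submodule.subset_span ⟨j, rfl⟩
  | zero => rw [map_zero]; exact Submodule.zero_mem _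
  | add x y _ _ hx hy => rw [map_add]; exact Submodule.add_mem _ hx hy
  | smul c x _ hx => rw [map_smul]; exact Submodule.smul_mem _ _ hx

variable (k d) in
/-- The splitting of `k[x₁, …, x_d] / 𝔪²` as the sum of `k` and `𝔪 / 𝔪²`. -/
def truncSplitting : SquareZeroSplitting k (TruncAlg k d) (mBar k d) where
  aug := aug k d
  incl := incl k d
  proj := proj k d
  eq_aug_add_incl := eq_aug_add_incl
  aug_incl := aug_incl
  proj_incl := proj_incl
  proj_one := proj_one
  incl_mul_incl := incl_mul_incl

end Splitting

/-! ### The two descriptions of the weight grading agree. -/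

section WeightPart

variable {k : Type u} [CommRing k] {d : ℕ}

theorem cons_mono_mem_weightPart {r w : ℕ} (o : Option (Fin d)) {x : ⨂[k]^r (TruncAlg k d)}
    (hx : x ∈ weightPart k d r w) :
    cons k (TruncAlg k d) r (mono k d o) x ∈
      weightPart k d (r + 1) (w + if o.isSome then 1 else 0) := by
  have : weightPart k d r w ≤ (weightPart k d (r + 1) (w + if o.isSome then 1 else 0)).comap
      (cons k (TruncAlg k d) r (mono k d o)) := by
    refine Submodule.span_le.2 ?_
    rintro _ ⟨v, rfl, rfl⟩
    refine Submodule.subset_span ⟨Fin.cons o v, ?_, ?_⟩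
    · simp only [monoWeight, Finset.card_filter, Fin.sum_univ_succ, Fin.cons_zero, Fin.cons_succ]
      exact add_comm _ _
    · rw [cons_tprod]
      congr 1
      ext i
      induction i using Fin.cases <;> simp
  exact this hx

/-- Words may have arbitrary letters in `M`; by linearity in the first letter it suffices to treat
the classes of the variables. -/
theorem wt_le_weightPart (r w : ℕ) : (truncSplitting k d).wt r w ≤ weightPart k d r w := by
  induction r generalizing w with
  | zero =>
    refine Submodule.span_le.2 ?_
    rintro _ ⟨c, rfl, rfl⟩
    refine Submodule.subset_span ⟨fun _ => none, ?_, congrArg _ (Subsingleton.elim _ _)⟩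
    simp [monoWeight, SquareZeroSplitting.wordWeight]
  | succ r ih =>
    apply SquareZeroSplitting.wt_succ_le
    · exact fun x hx => cons_mono_mem_weightPart none (ih w hx)
    · rintro v y rfl x hx
      have hy : y ∈ Submodule.span k (Set.range (gen k d)) := by rw [span_gen]; trivial
      have : Submodule.span k (Set.range (gen k d)) ≤ (weightPart k d (r + 1) (v + 1)).comap
          ((cons k (TruncAlg k d) r).flip x ∘ₗ (truncSplitting k d).incl) := by
        refine Submodule.span_le.2 ?_
        rintro _ ⟨j, rfl⟩
        exact cons_mono_mem_weightPart (some j) (ih v hx)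
      exact this hy

theorem wt_eq_weightPart (r w : ℕ) : (truncSplitting k d).wt r w = weightPart k d r w := by
  refine le_antisymm (wt_le_weightPart r w) (Submodule.span_le.2 ?_)
  rintro _ ⟨v, rfl, rfl⟩
  refine Submodule.subset_span ⟨fun i => (v i).map (gen k d), ?_, ?_⟩
  · simp [monoWeight, SquareZeroSplitting.wordWeight]
  · congr 1
    ext i
    change _ = (truncSplitting k d).letter ((v i).map (gen k d))
    cases v i <;> rfl

theorem tot_eq_totWeight (w : ℕ) : (truncSplitting k d).tot w = totWeight k d w := by
  simp only [SquareZeroSplitting.tot, totWeight, wt_eq_weightPart]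

end WeightPart

/-! ### The signed rotation as a representation of the cyclic group. -/

section CyclicRep

variable {k : Type u} [CommRing k] {M : Type u} [AddCommGroup M] [Module k M] (n : ℕ)

variable (k M) in
theorem range_normMap :
    LinearMap.range (normMap k M n) =
      (LinearMap.range (cycNorm k M n)).submoduleOf (LinearMap.ker (oneSubCyc k M n)) := by
  ext ⟨y, hy⟩
  constructor
  · rintro ⟨x, hx⟩
    obtain ⟨x, rfl⟩ := Submodule.Quotient.mk_surjective _ x
    exact ⟨x, congrArg Subtype.val hx⟩
  · rintro ⟨x, hx⟩
    exact ⟨Submodule.Quotient.mk x, Subtype.ext hx⟩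

variable (k M) in
theorem nonempty_ker_normMap_equiv :
    Nonempty (EndHomology (oneSubCyc k M n) (cycNorm k M n) ≃ₗ[k]
      LinearMap.ker (normMap k M n)) := by
  have hmem : ∀ x, Submodule.Quotient.mk x ∈ LinearMap.ker (normMap k M n) ↔
      x ∈ LinearMap.ker (cycNorm k M n) := fun x =>
    ⟨fun h => congrArg Subtype.val h, fun h => Subtype.ext h⟩
  let f : LinearMap.ker (cycNorm k M n) →ₗ[k] LinearMap.ker (normMap k M n) :=
    (Submodule.mkQ (LinearMap.range (oneSubCyc k M n))).restrict fun x hx => (hmem x).2 hx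
  have hf : Function.Surjective f := by
    rintro ⟨y, hy⟩
    obtain ⟨x, rfl⟩ := Submodule.Quotient.mk_surjective _ y
    exact ⟨⟨x, (hmem x).1 hy⟩, rfl⟩
  refine ⟨(Submodule.quotEquivOfEq _ _ ?_).trans (f.quotKerEquivOfSurjective hf)⟩
  ext ⟨x, hx⟩
  rw [LinearMap.mem_ker, Subtype.ext_iff]
  exact (Submodule.Quotient.mk_eq_zero (LinearMap.range (oneSubCyc k M n)) (x := x)).symm

/-- The generator `1 mod n` of the cyclic group of order `n`. -/
def cyclicGen : CyclicGroup.{u} n := ULift.up (Multiplicative.ofAdd 1)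

variable [NeZero n]

theorem mem_zpowers_cyclicGen (x : CyclicGroup.{u} n) : x ∈ Subgroup.zpowers (cyclicGen n) := by
  refine ⟨(x.down.toAdd.val : ℤ), ?_⟩
  apply ULift.down_injective
  apply Multiplicative.toAdd.injective
  simp [cyclicGen]

theorem cycRep_cyclicGen : cycRep k M n (cyclicGen n) = cyc k M n := by
  change cyc k M n ^ (1 : ZMod n).val = _
  obtain _ | _ | m := n
  · exact absurd rfl (NeZero.ne 0)
  -- For `n = 1` the class of `1` is `0` and acts by `t^0`; this agrees with `t`, which is the
  -- identity on `M^{⊗ 1}`.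
  · have := cyc_pow_self k M 1
    rw [pow_one] at this
    simp [this]
  · have : Fact (1 < m + 1 + 1) := ⟨by omega⟩
    rw [ZMod.val_one, pow_one]

theorem norm_cycRep [Fintype (CyclicGroup.{u} n)] : (cycRep k M n).norm = cycNorm k M n := by
  rw [Representation.norm, cycNorm]
  refine Finset.sum_bij (fun g _ => g.down.toAdd.val) ?_ ?_ ?_ ?_
  · intro g _
    exact Finset.mem_range.2 (ZMod.val_lt _)
  · intro g _ h _ hgh
    exact ULift.down_injective (Multiplicative.toAdd.injective (ZMod.val_injective n hgh))
  · intro j hj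
    refine ⟨ULift.up (Multiplicative.ofAdd (j : ZMod n)), Finset.mem_univ _, ?_⟩
    exact ZMod.val_cast_of_lt (Finset.mem_range.1 hj)
  · intro g _
    rfl

variable (k M) [Fintype (CyclicGroup.{u} n)]

theorem nonempty_evenTate_equiv :
    Nonempty (EndHomology (cycNorm k M n) (oneSubCyc k M n) ≃ₗ[k]
      EvenTate (Rep.of (cycRep k M n)) (cyclicGen n)) := by
  refine nonempty_subquotient_equiv (LinearEquiv.refl k _) _ _ _ _ (fun x => ?_) (fun x => ?_)
  · rw [LinearMap.mem_ker, LinearMap.mem_ker]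
    change _ ↔ (cycRep k M n (cyclicGen n) - 1) x = 0
    rw [cycRep_cyclicGen, ← neg_sub (1 : Module.End k _), LinearMap.neg_apply, neg_eq_zero]
  · change _ ↔ x ∈ LinearMap.range (cycRep k M n).norm
    rw [norm_cycRep]

theorem nonempty_oddTate_equiv :
    Nonempty (EndHomology (oneSubCyc k M n) (cycNorm k M n) ≃ₗ[k]
      OddTate (Rep.of (cycRep k M n)) (cyclicGen n)) := by
  refine nonempty_subquotient_equiv (LinearEquiv.refl k _) _ _ _ _ (fun x => ?_) (fun x => ?_)
  · change _ ↔ x ∈ LinearMap.ker (cycRep k M n).norm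
    rw [norm_cycRep]
  · change _ ↔ x ∈ LinearMap.range (cycRep k M n (cyclicGen n) - 1)
    rw [cycRep_cyclicGen, ← neg_sub (1 : Module.End k _), LinearMap.range_neg]

end CyclicRep

/-! ### Assembly of the results for `k[x₁, …, x_d] / 𝔪²`. -/

section Main

variable {k : Type u} [CommRing k] (d : ℕ) (n : ℤ)

theorem isInternal_weightPart (r : ℕ) : DirectSum.IsInternal fun w : ℕ => weightPart k d r w := by
  simpa only [wt_eq_weightPart] using (truncSplitting k d).isInternal_wt r

theorem map_totD_totWeight_le (w : ℕ) :
    (totWeight k d w).map (totD k (TruncAlg k d) n) ≤ totWeight k d w := by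
  rw [← tot_eq_totWeight]
  rintro _ ⟨z, hz, rfl⟩
  exact SquareZeroSplitting.totD_mem hz

theorem exists_HP_equiv_pi :
    ∃ Φ : HP k (TruncAlg k d) n ≃ₗ[k] ∀ w : ℕ, HPWeight k d w n,
      (∀ (z : cycles k (TruncAlg k d) n) (c : ∀ w : ℕ, weightCycles k d w n),
        (∀ q : ℕ, (z : Tot k (TruncAlg k d)) q =
          ∑ w ∈ Finset.range (q + 2), (c w : Tot k (TruncAlg k d)) q) →
        Φ (Submodule.Quotient.mk z) = fun w => Submodule.Quotient.mk (c w)) ∧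
      ∀ (w : ℕ) (x : HPWeight k d w n), Φ (weightIncl k d w n x) = Pi.single w x := by
  obtain ⟨Φ, hΦ⟩ : ∃ Φ : HP k (TruncAlg k d) n ≃ₗ[k] ∀ w : ℕ, HPWeight k d w n,
      ∀ (z : cycles k (TruncAlg k d) n) (c : ∀ w : ℕ, weightCycles k d w n),
        (∀ w, (truncSplitting k d).totProj w z = c w) →
        Φ (Submodule.Quotient.mk z) = fun w => Submodule.Quotient.mk (c w) := by
    have h := (truncSplitting k d).exists_homology_equiv n
    rw [show (truncSplitting k d).tot = totWeight k d from funext tot_eq_totWeight] at h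
    exact h
  refine ⟨Φ, fun z c h => hΦ z c ?_, fun w x => ?_⟩
  · refine (truncSplitting k d).totProj_of_eq_sum (c := fun w => (c w : Tot k (TruncAlg k d)))
      (fun w => ?_) h
    rw [tot_eq_totWeight]
    exact (c w).2.2
  · obtain ⟨x, rfl⟩ := Submodule.Quotient.mk_surjective _ x
    refine (hΦ ⟨x, x.2.1⟩ (Pi.single w x) fun v => ?_).trans ?_
    · have hx : (x : Tot k (TruncAlg k d)) ∈ (truncSplitting k d).tot w := by
        rw [tot_eq_totWeight]
        exact x.2.2
      rw [(truncSplitting k d).totProj_of_mem v hx]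
      by_cases hv : w = v
      · subst hv
        simp
      · simp [hv]
    · ext v
      by_cases hv : v = w
      · subst hv
        simp
      · simp [Pi.single_eq_of_ne hv]

variable {n}

theorem nonempty_HPWeight_zero_equiv (hn : Even n) : Nonempty (HPWeight k d 0 n ≃ₗ[k] k) := by
  have h := (truncSplitting k d).nonempty_homology_zero_equiv n hn
  rwa [tot_eq_totWeight] at h

theorem subsingleton_HPWeight_zero (hn : Odd n) : Subsingleton (HPWeight k d 0 n) := by
  have h := (truncSplitting k d).subsingleton_homology_zero n hn
  rwa [tot_eq_totWeight] at h

variable {w : ℕ} [NeZero w]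

theorem nonempty_HPWeight_equiv_of_even (hn : Even (n - w)) :
    Nonempty (HPWeight k d w n ≃ₗ[k]
      EndHomology (cycNorm k (mBar k d) w) (oneSubCyc k (mBar k d) w)) := by
  obtain ⟨m, rfl⟩ := Nat.exists_eq_succ_of_ne_zero (NeZero.ne w)
  have h := (truncSplitting k d).nonempty_homology_equiv_periodic n m
  rw [tot_eq_totWeight] at h
  -- The periodic complex is indexed by `m = w - 1`, so the parity of `n - m` is opposite to that of
  -- `n - w`.
  have h0 : ¬ Even (n - m) := by grind
  have h1 : Even (n + 1 - m) := by grind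
  rwa [SquareZeroSplitting.periodicD, SquareZeroSplitting.periodicD, if_neg h0, if_pos h1] at h

theorem nonempty_HPWeight_equiv_of_odd (hn : Odd (n - w)) :
    Nonempty (HPWeight k d w n ≃ₗ[k]
      EndHomology (oneSubCyc k (mBar k d) w) (cycNorm k (mBar k d) w)) := by
  obtain ⟨m, rfl⟩ := Nat.exists_eq_succ_of_ne_zero (NeZero.ne w)
  have h := (truncSplitting k d).nonempty_homology_equiv_periodic n m
  rw [tot_eq_totWeight] at h
  have h0 : Even (n - m) := by grind
  have h1 : ¬ Even (n + 1 - m) := by grind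
  rwa [SquareZeroSplitting.periodicD, SquareZeroSplitting.periodicD, if_pos h0, if_neg h1] at h

variable (n w) in
theorem nonempty_HPWeight_equiv_tateCohomology :
    Nonempty (HPWeight k d w n ≃ₗ[k] tateCohomology (mBarRep k d w) (w - n)) := by
  rcases Int.even_or_odd (n - w) with hn | hn
  · obtain ⟨e₁⟩ := nonempty_HPWeight_equiv_of_even (k := k) d hn
    obtain ⟨e₂⟩ := nonempty_evenTate_equiv k (mBar k d) w
    obtain ⟨e₃⟩ := nonempty_tateCohomology_even_equiv (mBarRep k d w) (mem_zpowers_cyclicGen w)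
      (i := w - n) (by grind)
    exact ⟨(e₁.trans e₂).trans e₃.symm⟩
  · obtain ⟨e₁⟩ := nonempty_HPWeight_equiv_of_odd (k := k) d hn
    obtain ⟨e₂⟩ := nonempty_oddTate_equiv k (mBar k d) w
    obtain ⟨e₃⟩ := nonempty_tateCohomology_odd_equiv (mBarRep k d w) (mem_zpowers_cyclicGen w)
      (i := w - n) (by grind)
    exact ⟨(e₁.trans e₂).trans e₃.symm⟩

end Main

end CyclicHomology

end

open CyclicHomology in
theorem mainTheorem5 {k : Type*} [CommRing k] (d : ℕ) :
    -- the periodic cyclic bicomplex of `A` is the direct sum of its weight parts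
    ((∀ r : ℕ, DirectSum.IsInternal fun w : ℕ => weightPart k d r w) ∧
      (∀ n : ℤ, totD k (TruncAlg k d) (n - 1) ∘ₗ totD k (TruncAlg k d) n = 0) ∧
      (∀ (w : ℕ) (n : ℤ),
        (totWeight k d w).map (totD k (TruncAlg k d) n) ≤ totWeight k d w)) ∧
    -- periodic cyclic homology is the product of its weight parts, through the decomposition of
    -- cycles into their weight components (the elements of `A^{⊗ q+1}` have weights `≤ q + 1`);
    -- the inclusion of the weight `w` subcomplex becomes the inclusion of the `w`-th factor
    (∀ n : ℤ, ∃ Φ : HP k (TruncAlg k d) n ≃ₗ[k] ∀ w : ℕ, HPWeight k d w n,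
      (∀ (z : cycles k (TruncAlg k d) n) (c : ∀ w : ℕ, weightCycles k d w n),
        (∀ q : ℕ, (z : Tot k (TruncAlg k d)) q =
          ∑ w ∈ Finset.range (q + 2), (c w : Tot k (TruncAlg k d)) q) →
        Φ (Submodule.Quotient.mk z) = fun w => Submodule.Quotient.mk (c w)) ∧
      ∀ (w : ℕ) (x : HPWeight k d w n), Φ (weightIncl k d w n x) = Pi.single w x) ∧
    -- weight zero
    (∀ n : ℤ, (Even n → Nonempty (HPWeight k d 0 n ≃ₗ[k] k)) ∧
      (Odd n → Subsingleton (HPWeight k d 0 n))) ∧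
    -- positive weight
    (∀ (w : ℕ) [NeZero w] (n : ℤ),
      (Even (n - w) → Nonempty (HPWeight k d w n ≃ₗ[k]
        (LinearMap.ker (oneSubCyc k (mBar k d) w) ⧸
          LinearMap.range (normMap k (mBar k d) w)))) ∧
      (Odd (n - w) → Nonempty (HPWeight k d w n ≃ₗ[k]
        LinearMap.ker (normMap k (mBar k d) w))) ∧
      Nonempty (HPWeight k d w n ≃ₗ[k] tateCohomology (mBarRep k d w) (w - n))) := by
  refine ⟨⟨isInternal_weightPart d, totD_comp_totD, fun w n => map_totD_totWeight_le d n w⟩,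
    exists_HP_equiv_pi d, fun n => ⟨nonempty_HPWeight_zero_equiv d, subsingleton_HPWeight_zero d⟩,
    fun w _ n => ⟨fun hn => ?_, fun hn => ?_, nonempty_HPWeight_equiv_tateCohomology d n w⟩⟩
  · obtain ⟨e⟩ := nonempty_HPWeight_equiv_of_even (k := k) d hn
    exact ⟨e.trans (Submodule.quotEquivOfEq _ _ (range_normMap k (mBar k d) w).symm)⟩
  · obtain ⟨e⟩ := nonempty_HPWeight_equiv_of_odd (k := k) d hn
    obtain ⟨e'⟩ := nonempty_ker_normMap_equiv k (mBar k d) w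
    exact ⟨e.trans e'⟩
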